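/- **Conventions.** Let $[n]=q^{n-1}+q^{n-3}+\cdots+q^{1-n}$. For $k\ge 1$ let $s_k=\sum_{i\ge 0}\bigl(q^{(2i+1)k-1}-q^{(2i+1)k+1}\bigr)$, the expansion of $1/[k]$ in positive powers of $q$. For $N\ge 1$ let $R^N$ be the subring of the ring $\mathbb Z((q))$ of Laurent series generated by $q,q^{-1},s_1,\dots,s_N$. For a disk or annulus $\Sigma$ with marked points on its boundary, $\mathrm{TL}^N(\Sigma)$ is the $R^N$-module of linear combinations of isotopy classes (rel boundary) of multi-curves in $\Sigma$ ending at the marked points, modulo the relation that a simple closed curve bounding a disk may be removed at the price of the factor $[2]=q+q^{-1}$. Write $\mathrm{TL}^N_n$ for the disk (a rectangle) with $n$ marked points at the top and $n$ at the bottom. The Jones–Wenzl projectors $p_n\in \mathrm{TL}^N_n$, $0\le n\le N$, are $p_0=\emptyset$, $p_1=$ one strand, and $$p_n=p_{n-1}\otimes 1-[n-1]\,s_n\,(p_{n-1}\otimes 1)\,e_{n-1}\,(p_{n-1}\otimes 1),$$ where $e_{n-1}$ joins the last two bottom points and the last two top points. $\mathrm{Tr}(x)\in R^N$ is the scalar $r$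 such that the planar closure of $x$ equals $r\cdot\emptyset$. $\phi_k\in \mathrm{TL}^N(S^1\times I)$ is the closure of $p_k$ around the hole of the annulus. The ideal $\langle p_N\rangle\subset \mathrm{TL}^N(\Sigma)$ is the submodule spanned by all elements obtained by gluing $p_N$, placed in a disk in the interior of $\Sigma$, to anything outside that disk. **Statement.** Let $N\ge 1$ and $$\omega_N=\sum_{k=0}^{N}\mathrm{Tr}(p_k)\,\phi_k\in \mathrm{TL}^N(S^1\times I).$$ Then $\omega_N$ is invariant under handle slides modulo $\langle p_N\rangle$. That is, let the annulus $S^1\times I$ carry any numbers of marked points on its two boundary circles, and place $\omega_N$ in a thinner annulus around its core. In the rest of the surface take any multi-curve (or linear combination of such) containing an arc that runs next to the thin annulus, outside or inside of it. Replace this arc by its band sum with a parallel copy of the core circle, so that it has the same endpoints but passes the thin annulus on the other side of the hole. The two resulting elements of $\mathrm{TL}^N(S^1\times I)$ (with these marked points) are equal in $\mathrm{TL}^N(S^1\times I)/\langle p_N\rangle$. In particular, for the annulus with two marked points on the outer circle and none on the inner one, the two arcs joining the marked points on either side of the hole, each taken together with $\omega_N$ around the hole, are equal modulo $\langle p_N\rangle$.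 -/

import Mathlib

/-!
Temperley-Lieb spaces of the disk (drawn as a rectangle) and of the annulus, Jones-Wenzl
projectors over the restricted ring, ideals generated by gluing, the magic element, handle slides.

Multi-curves are drawn in general position with respect to the height function of the rectangle
`[0,1] × [0,1]`, respectively the radial function of the annulus `S¹ × [0,1]`, so that they are
words of elementary layers, and isotopy rel boundary is the equivalence relation generated by the
elementary planar moves.
-/

namespace TemperleyLieb

noncomputable section

/-! ### Multi-curves -/

/-- The two surfaces: the disk, viewed as a rectangle with marked points on its bottom and top
edges, and the annulus with marked points on its inner (bottom) and outer (top) circles. -/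
inductive Shape
  | rectangle
  | annulus

/-- `Diagram S n m`: multi-curves in general position on `S`, with `n` marked points on the bottom
(inner) boundary and `m` marked points on the top (outer) boundary, read from bottom to top.
The points of a level are numbered `0, 1, …` from left to right; on an annulus the numbering starts
at a fixed radial cut.
* `id`: vertical strands.
* `cup i`: on top of the diagram, a new local minimum is born; its two ends have numbers `i, i+1`.
* `cap i`: on top of the diagram, the strands `i, i+1` are joined by a local maximum.
* `rot`: (annulus only) on top of the diagram all strands move one place to the right, the last one
  crossing the cut and becoming number `0`; `unrot` is the same motion to the left. -/
inductive Diagram (S : Shape) (n : ℕ) : ℕ → Type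
  | id : Diagram S n n
  | cup {m : ℕ} (D : Diagram S n m) (i : ℕ) (hi : i ≤ m) : Diagram S n (m + 2)
  | cap {m : ℕ} (D : Diagram S n (m + 2)) (i : ℕ) (hi : i ≤ m) : Diagram S n m
  | rot {m : ℕ} (hS : S = .annulus) (D : Diagram S n m) : Diagram S n m
  | unrot {m : ℕ} (hS : S = .annulus) (D : Diagram S n m) : Diagram S n m

/-- Gluing the bottom of `E` to the top of `D` (stacking in the rectangle, gluing annuli along a
common boundary circle). -/
def Diagram.comp {S : Shape} {n m : ℕ} (D : Diagram S n m) :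
    {k : ℕ} → Diagram S m k → Diagram S n k
  | _, .id => D
  | _, .cup E i hi => (D.comp E).cup i hi
  | _, .cap E i hi => (D.comp E).cap i hi
  | _, .rot hS E => (D.comp E).rot hS
  | _, .unrot hS E => (D.comp E).unrot hS

/-- Isotopy rel boundary of multi-curves in general position. The elementary moves are: exchange of
the heights of two distant critical points; birth and death of a pair of critical points on a strand
(zigzag); and, on the annulus, moving strands, local minima and local maxima across the radial cut.
-/
inductive Isotopic {S : Shape} {n : ℕ} : {m : ℕ} → Diagram S n m → Diagram S n m → Prop
  | refl {m : ℕ} (D : Diagram S n m) : Isotopic D D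
  | symm {m : ℕ} {D E : Diagram S n m} : Isotopic D E → Isotopic E D
  | trans {m : ℕ} {D E F : Diagram S n m} : Isotopic D E → Isotopic E F → Isotopic D F
  | congr_cup {m : ℕ} {D E : Diagram S n m} (i : ℕ) (hi : i ≤ m) :
      Isotopic D E → Isotopic (D.cup i hi) (E.cup i hi)
  | congr_cap {m : ℕ} {D E : Diagram S n (m + 2)} (i : ℕ) (hi : i ≤ m) :
      Isotopic D E → Isotopic (D.cap i hi) (E.cap i hi)
  | congr_rot {m : ℕ} {D E : Diagram S n m} (hS : S = .annulus) :
      Isotopic D E → Isotopic (D.rot hS) (E.rot hS)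
  | congr_unrot {m : ℕ} {D E : Diagram S n m} (hS : S = .annulus) :
      Isotopic D E → Isotopic (D.unrot hS) (E.unrot hS)
  | zigzag_right {m : ℕ} (D : Diagram S n m) (i : ℕ) (hi : i + 1 ≤ m) :
      Isotopic ((D.cup i (by omega)).cap (i + 1) hi) D
  | zigzag_left {m : ℕ} (D : Diagram S n m) (i : ℕ) (hi : i + 1 ≤ m) :
      Isotopic ((D.cup (i + 1) hi).cap i (by omega)) D
  | cup_cup {m : ℕ} (D : Diagram S n m) (i j : ℕ) (hij : i ≤ j) (hj : j ≤ m) :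
      Isotopic ((D.cup j hj).cup i (by omega)) ((D.cup i (by omega)).cup (j + 2) (by omega))
  | cap_cap {m : ℕ} (D : Diagram S n (m + 2 + 2)) (i j : ℕ) (hij : i ≤ j) (hj : j ≤ m) :
      Isotopic ((D.cap (j + 2) (by omega)).cap i (by omega)) ((D.cap i (by omega)).cap j hj)
  | cup_cap {m : ℕ} (D : Diagram S n (m + 2)) (i j : ℕ) (hij : i ≤ j) (hj : j ≤ m) :
      Isotopic ((D.cup i (by omega)).cap (j + 2) (by omega)) ((D.cap j hj).cup i (by omega))
  | cap_cup {m : ℕ} (D : Diagram S n (m + 2)) (i j : ℕ) (hij : i ≤ j) (hj : j ≤ m) :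
      Isotopic ((D.cup (j + 2) (by omega)).cap i (by omega)) ((D.cap i (by omega)).cup j hj)
  | unrot_rot {m : ℕ} (hS : S = .annulus) (D : Diagram S n m) :
      Isotopic ((D.rot hS).unrot hS) D
  | rot_unrot {m : ℕ} (hS : S = .annulus) (D : Diagram S n m) :
      Isotopic ((D.unrot hS).rot hS) D
  | rot_zero (hS : S = .annulus) (D : Diagram S n 0) : Isotopic (D.rot hS) D
  | rot_cup {m : ℕ} (hS : S = .annulus) (D : Diagram S n m) (i : ℕ) (hi : i < m) :
      Isotopic ((D.cup i hi.le).rot hS) ((D.rot hS).cup (i + 1) hi)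
  | rot_rot_cup {m : ℕ} (hS : S = .annulus) (D : Diagram S n m) :
      Isotopic (((D.cup m le_rfl).rot hS).rot hS) (D.cup 0 (Nat.zero_le m))
  | rot_cap {m : ℕ} (hS : S = .annulus) (D : Diagram S n (m + 2)) (i : ℕ) (hi : i < m) :
      Isotopic ((D.cap i hi.le).rot hS) ((D.rot hS).cap (i + 1) hi)
  | cap_rot_rot {m : ℕ} (hS : S = .annulus) (D : Diagram S n (m + 2)) :
      Isotopic (((D.rot hS).rot hS).cap 0 (Nat.zero_le m)) (D.cap m le_rfl)

theorem Isotopic.comp_left {S : Shape} {n m : ℕ} {D D' : Diagram S n m} (h : Isotopic D D')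
    {k : ℕ} (E : Diagram S m k) : Isotopic (D.comp E) (D'.comp E) := by
  induction E with
  | id => exact h
  | cup E i hi ih => exact .congr_cup i hi ih
  | cap E i hi ih => exact .congr_cap i hi ih
  | rot hS E ih => exact .congr_rot hS ih
  | unrot hS E ih => exact .congr_unrot hS ih

theorem Isotopic.comp_right {S : Shape} {n m : ℕ} (D : Diagram S n m)
    {k : ℕ} {E E' : Diagram S m k} (h : Isotopic E E') : Isotopic (D.comp E) (D.comp E') := by
  induction h with
  | refl E => exact .refl _
  | symm _ ih => exact .symm ih
  | trans _ _ ih₁ ih₂ => exact .trans ih₁ ih₂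
  | congr_cup i hi _ ih => exact .congr_cup i hi ih
  | congr_cap i hi _ ih => exact .congr_cap i hi ih
  | congr_rot hS _ ih => exact .congr_rot hS ih
  | congr_unrot hS _ ih => exact .congr_unrot hS ih
  | zigzag_right E i hi => exact .zigzag_right _ i hi
  | zigzag_left E i hi => exact .zigzag_left _ i hi
  | cup_cup E i j hij hj => exact .cup_cup _ i j hij hj
  | cap_cap E i j hij hj => exact .cap_cap _ i j hij hj
  | cup_cap E i j hij hj => exact .cup_cap _ i j hij hj
  | cap_cup E i j hij hj => exact .cap_cup _ i j hij hj
  | unrot_rot hS E => exact .unrot_rot hS _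
  | rot_unrot hS E => exact .rot_unrot hS _
  | rot_zero hS E => exact .rot_zero hS _
  | rot_cup hS E i hi => exact .rot_cup hS _ i hi
  | rot_rot_cup hS E => exact .rot_rot_cup hS _
  | rot_cap hS E i hi => exact .rot_cap hS _ i hi
  | cap_rot_rot hS E => exact .cap_rot_rot hS _

/-- The rectangle, widened by one vertical strand on the right. -/
def Diagram.strandRight {n : ℕ} : {m : ℕ} → Diagram .rectangle n m →
    Diagram .rectangle (n + 1) (m + 1)
  | _, .id => .id
  | _, .cup (m := m) D i hi => Diagram.cup (m := m + 1) D.strandRight i (by omega)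
  | _, .cap (m := m) D i hi => Diagram.cap (m := m + 1) D.strandRight i (by omega)

/-- The rectangle, widened by one vertical strand on the left. -/
def Diagram.strandLeft {n : ℕ} : {m : ℕ} → Diagram .rectangle n m →
    Diagram .rectangle (n + 1) (m + 1)
  | _, .id => .id
  | _, .cup (m := m) D i hi => Diagram.cup (m := m + 1) D.strandLeft (i + 1) (by omega)
  | _, .cap (m := m) D i hi => Diagram.cap (m := m + 1) D.strandLeft (i + 1) (by omega)

/-- The annulus is obtained from the rectangle by gluing its left edge to its right edge along the
radial cut. -/
def Diagram.toAnnulus {n : ℕ} : {m : ℕ} → Diagram .rectangle n m → Diagram .annulus n m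
  | _, .id => .id
  | _, .cup D i hi => D.toAnnulus.cup i hi
  | _, .cap D i hi => D.toAnnulus.cap i hi

theorem Isotopic.strandRight {n m : ℕ} {D E : Diagram .rectangle n m} (h : Isotopic D E) :
    Isotopic D.strandRight E.strandRight := by
  induction h with
  | refl E => exact .refl _
  | symm _ ih => exact .symm ih
  | trans _ _ ih₁ ih₂ => exact .trans ih₁ ih₂
  | congr_cup i hi _ ih => exact .congr_cup (m := _ + 1) i (by omega) ih
  | congr_cap i hi _ ih => exact .congr_cap (m := _ + 1) i (by omega) ih
  | zigzag_right E i hi => exact .zigzag_right (m := _ + 1) _ i (by omega)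
  | zigzag_left E i hi => exact .zigzag_left (m := _ + 1) _ i (by omega)
  | cup_cup E i j hij hj => exact .cup_cup (m := _ + 1) _ i j hij (by omega)
  | cap_cap E i j hij hj => exact .cap_cap (m := _ + 1) _ i j hij (by omega)
  | cup_cap E i j hij hj => exact .cup_cap (m := _ + 1) _ i j hij (by omega)
  | cap_cup E i j hij hj => exact .cap_cup (m := _ + 1) _ i j hij (by omega)
  | congr_rot hS | congr_unrot hS | unrot_rot hS | rot_unrot hS | rot_zero hS | rot_cup hS
  | rot_rot_cup hS | rot_cap hS | cap_rot_rot hS => cases hS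

theorem Isotopic.strandLeft {n m : ℕ} {D E : Diagram .rectangle n m} (h : Isotopic D E) :
    Isotopic D.strandLeft E.strandLeft := by
  induction h with
  | refl E => exact .refl _
  | symm _ ih => exact .symm ih
  | trans _ _ ih₁ ih₂ => exact .trans ih₁ ih₂
  | congr_cup i hi _ ih => exact .congr_cup (m := _ + 1) (i + 1) (by omega) ih
  | congr_cap i hi _ ih => exact .congr_cap (m := _ + 1) (i + 1) (by omega) ih
  | zigzag_right E i hi => exact .zigzag_right (m := _ + 1) _ (i + 1) (by omega)
  | zigzag_left E i hi => exact .zigzag_left (m := _ + 1) _ (i + 1) (by omega)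
  | cup_cup E i j hij hj => exact .cup_cup (m := _ + 1) _ (i + 1) (j + 1) (by omega) (by omega)
  | cap_cap E i j hij hj => exact .cap_cap (m := _ + 1) _ (i + 1) (j + 1) (by omega) (by omega)
  | cup_cap E i j hij hj => exact .cup_cap (m := _ + 1) _ (i + 1) (j + 1) (by omega) (by omega)
  | cap_cup E i j hij hj => exact .cap_cup (m := _ + 1) _ (i + 1) (j + 1) (by omega) (by omega)
  | congr_rot hS | congr_unrot hS | unrot_rot hS | rot_unrot hS | rot_zero hS | rot_cup hS
  | rot_rot_cup hS | rot_cap hS | cap_rot_rot hS => cases hS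

theorem Isotopic.toAnnulus {n m : ℕ} {D E : Diagram .rectangle n m} (h : Isotopic D E) :
    Isotopic D.toAnnulus E.toAnnulus := by
  induction h with
  | refl E => exact .refl _
  | symm _ ih => exact .symm ih
  | trans _ _ ih₁ ih₂ => exact .trans ih₁ ih₂
  | congr_cup i hi _ ih => exact .congr_cup i hi ih
  | congr_cap i hi _ ih => exact .congr_cap i hi ih
  | zigzag_right E i hi => exact .zigzag_right _ i hi
  | zigzag_left E i hi => exact .zigzag_left _ i hi
  | cup_cup E i j hij hj => exact .cup_cup _ i j hij hj
  | cap_cap E i j hij hj => exact .cap_cap _ i j hij hj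
  | cup_cap E i j hij hj => exact .cup_cap _ i j hij hj
  | cap_cup E i j hij hj => exact .cap_cup _ i j hij hj
  | congr_rot hS | congr_unrot hS | unrot_rot hS | rot_unrot hS | rot_zero hS | rot_cup hS
  | rot_rot_cup hS | rot_cap hS | cap_rot_rot hS => cases hS

theorem Diagram.strandRight_comp {n m k : ℕ} (D : Diagram .rectangle n m)
    (E : Diagram .rectangle m k) :
    (D.comp E).strandRight = D.strandRight.comp E.strandRight := by
  induction E with
  | id => rfl
  | cup E i hi ih => simp only [Diagram.comp, Diagram.strandRight, ih]
  | cap E i hi ih => simp only [Diagram.comp, Diagram.strandRight, ih]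
  | rot hS => cases hS
  | unrot hS => cases hS

theorem Diagram.strandLeft_comp {n m k : ℕ} (D : Diagram .rectangle n m)
    (E : Diagram .rectangle m k) :
    (D.comp E).strandLeft = D.strandLeft.comp E.strandLeft := by
  induction E with
  | id => rfl
  | cup E i hi ih => simp only [Diagram.comp, Diagram.strandLeft, ih]
  | cap E i hi ih => simp only [Diagram.comp, Diagram.strandLeft, ih]
  | rot hS => cases hS
  | unrot hS => cases hS

theorem Diagram.toAnnulus_comp {n m k : ℕ} (D : Diagram .rectangle n m)
    (E : Diagram .rectangle m k) :
    (D.comp E).toAnnulus = D.toAnnulus.comp E.toAnnulus := by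
  induction E with
  | id => rfl
  | cup E i hi ih => simp only [Diagram.comp, Diagram.toAnnulus, ih]
  | cap E i hi ih => simp only [Diagram.comp, Diagram.toAnnulus, ih]
  | rot hS => cases hS
  | unrot hS => cases hS

theorem Diagram.comp_assoc {S : Shape} {n m k l : ℕ} (D : Diagram S n m) (E : Diagram S m k)
    (F : Diagram S k l) : (D.comp E).comp F = D.comp (E.comp F) := by
  induction F with
  | id => rfl
  | cup F i hi ih => simp only [Diagram.comp, ih]
  | cap F i hi ih => simp only [Diagram.comp, ih]
  | rot hS F ih => simp only [Diagram.comp, ih]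
  | unrot hS F ih => simp only [Diagram.comp, ih]

instance isotopySetoid (S : Shape) (n m : ℕ) : Setoid (Diagram S n m) where
  r := Isotopic
  iseqv := ⟨.refl, .symm, .trans⟩

/-- Isotopy classes of multi-curves. -/
def Multicurve (S : Shape) (n m : ℕ) : Type := Quotient (isotopySetoid S n m)

/-- The isotopy class of a multi-curve in general position. -/
def Diagram.cls {S : Shape} {n m : ℕ} (D : Diagram S n m) : Multicurve S n m := Quotient.mk _ D

def Multicurve.comp {S : Shape} {n m k : ℕ} (x : Multicurve S n m) (y : Multicurve S m k) :
    Multicurve S n k :=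
  Quotient.map₂ (fun D E => D.comp E)
    (fun _ D' h E _ h' => Isotopic.trans (Isotopic.comp_left h E) (Isotopic.comp_right D' h')) x y

def Multicurve.strandRight {n m : ℕ} (x : Multicurve .rectangle n m) :
    Multicurve .rectangle (n + 1) (m + 1) :=
  Quotient.map Diagram.strandRight (fun _ _ h => Isotopic.strandRight h) x

def Multicurve.strandLeft {n m : ℕ} (x : Multicurve .rectangle n m) :
    Multicurve .rectangle (n + 1) (m + 1) :=
  Quotient.map Diagram.strandLeft (fun _ _ h => Isotopic.strandLeft h) x

def Multicurve.toAnnulus {n m : ℕ} (x : Multicurve .rectangle n m) : Multicurve .annulus n m :=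
  Quotient.map Diagram.toAnnulus (fun _ _ h => Isotopic.toAnnulus h) x

/-! ### Temperley-Lieb spaces -/

section TL

variable (R : Type) [CommRing R] (q : Rˣ)

/-- The span of the local relation: a simple closed curve bounding a disk (in general position, a
local minimum followed at once by a local maximum on the same two strands, anywhere in the
multi-curve) may be removed at the price of the factor `q + q⁻¹`. -/
def circleRelations (S : Shape) (n m : ℕ) : Submodule R (Multicurve S n m →₀ R) :=
  Submodule.span R {x | ∃ (k : ℕ) (D : Diagram S n k) (i : ℕ) (hi : i ≤ k) (F : Diagram S k m),
    x = Finsupp.single (((D.cup i hi).cap i hi).comp F).cls 1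
      - (q + (q⁻¹ : Rˣ) : R) • Finsupp.single (D.comp F).cls 1}

/-- The Temperley-Lieb space with coefficients in `R`: linear combinations of isotopy classes of
multi-curves modulo the local relation. -/
abbrev TL (S : Shape) (n m : ℕ) : Type := (Multicurve S n m →₀ R) ⧸ circleRelations R q S n m

/-- The element of the Temperley-Lieb space represented by one multi-curve. -/
def ofDiagram {S : Shape} {n m : ℕ} (D : Diagram S n m) : TL R q S n m :=
  Submodule.Quotient.mk (Finsupp.single D.cls 1)

variable {R}

theorem ofDiagram_circle {S : Shape} {n k m : ℕ} (D : Diagram S n k) (i : ℕ) (hi : i ≤ k)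
    (F : Diagram S k m) :
    ofDiagram R q (((D.cup i hi).cap i hi).comp F)
      = (q + (q⁻¹ : Rˣ) : R) • ofDiagram R q (D.comp F) := by
  unfold ofDiagram
  rw [← Submodule.Quotient.mk_smul, Submodule.Quotient.eq]
  exact Submodule.subset_span ⟨k, D, i, hi, F, rfl⟩

theorem ofDiagram_eq {S : Shape} {n m : ℕ} {D E : Diagram S n m} (h : Isotopic D E) :
    ofDiagram R q D = ofDiagram R q E := by
  unfold ofDiagram
  rw [show D.cls = E.cls from Quotient.sound h]

/-- The linear extension of an operation on multi-curves which respects the local relation. -/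
def liftOp {S T : Shape} {n m n' m' : ℕ} (f : Multicurve S n m → Multicurve T n' m')
    (hf : ∀ (k : ℕ) (D : Diagram S n k) (i : ℕ) (hi : i ≤ k) (F : Diagram S k m),
      (Submodule.Quotient.mk (Finsupp.single (f (((D.cup i hi).cap i hi).comp F).cls) 1) :
          TL R q T n' m')
        = (q + (q⁻¹ : Rˣ) : R) •
          Submodule.Quotient.mk (Finsupp.single (f (D.comp F).cls) 1)) :
    TL R q S n m →ₗ[R] TL R q T n' m' :=
  Submodule.liftQ _ ((circleRelations R q T n' m').mkQ ∘ₗ Finsupp.lmapDomain R R f) (by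
    refine Submodule.span_le.2 ?_
    rintro _ ⟨k, D, i, hi, F, rfl⟩
    have h := hf k D i hi F
    rw [← sub_eq_zero] at h
    rw [SetLike.mem_coe, LinearMap.mem_ker, map_sub, map_smul]
    simpa [Finsupp.mapDomain_single] using h)

theorem liftOp_mk {S T : Shape} {n m n' m' : ℕ} (f : Multicurve S n m → Multicurve T n' m') (hf)
    (x : Multicurve S n m) :
    liftOp q f hf (Submodule.Quotient.mk (Finsupp.single x 1) : TL R q S n m)
      = (Submodule.Quotient.mk (Finsupp.single (f x) 1) : TL R q T n' m') := by
  change Submodule.Quotient.mk (Finsupp.mapDomain f (Finsupp.single x 1)) = _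
  rw [Finsupp.mapDomain_single]

/-- One more strand on the right. -/
def strandRight {n m : ℕ} :
    TL R q .rectangle n m →ₗ[R] TL R q .rectangle (n + 1) (m + 1) :=
  liftOp q Multicurve.strandRight (by
    intro k D i hi F
    have h := ofDiagram_circle q D.strandRight i (Nat.le_succ_of_le hi) F.strandRight
    have h₁ := Diagram.strandRight_comp ((D.cup i hi).cap i hi) F
    have h₂ := Diagram.strandRight_comp D F
    change ofDiagram R q (Diagram.strandRight _) = _ • ofDiagram R q (Diagram.strandRight _)
    rw [h₁, h₂]
    exact h)

/-- One more strand on the left. -/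
def strandLeft {n m : ℕ} :
    TL R q .rectangle n m →ₗ[R] TL R q .rectangle (n + 1) (m + 1) :=
  liftOp q Multicurve.strandLeft (by
    intro k D i hi F
    have h := ofDiagram_circle q D.strandLeft (i + 1) (Nat.succ_le_succ hi) F.strandLeft
    have h₁ := Diagram.strandLeft_comp ((D.cup i hi).cap i hi) F
    have h₂ := Diagram.strandLeft_comp D F
    change ofDiagram R q (Diagram.strandLeft _) = _ • ofDiagram R q (Diagram.strandLeft _)
    rw [h₁, h₂]
    exact h)

/-- The map induced by the inclusion of the rectangle in the annulus. -/
def toAnnulus {n m : ℕ} : TL R q .rectangle n m →ₗ[R] TL R q .annulus n m :=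
  liftOp q Multicurve.toAnnulus (by
    intro k D i hi F
    have h := ofDiagram_circle q D.toAnnulus i hi F.toAnnulus
    have h₁ := Diagram.toAnnulus_comp ((D.cup i hi).cap i hi) F
    have h₂ := Diagram.toAnnulus_comp D F
    change ofDiagram R q (Diagram.toAnnulus _) = _ • ofDiagram R q (Diagram.toAnnulus _)
    rw [h₁, h₂]
    exact h)

/-- Gluing a fixed multi-curve on top. -/
def glueTop {S : Shape} {n m k : ℕ} (y : Multicurve S m k) :
    TL R q S n m →ₗ[R] TL R q S n k :=
  liftOp q (fun x => x.comp y) (by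
    intro l D i hi F
    induction y using Quotient.inductionOn with
    | h E =>
      have h := ofDiagram_circle q D i hi (F.comp E)
      have h₁ := Diagram.comp_assoc ((D.cup i hi).cap i hi) F E
      have h₂ := Diagram.comp_assoc D F E
      rw [← h₁, ← h₂] at h
      exact h)

theorem glueTop_ofDiagram {S : Shape} {n m k : ℕ} (D : Diagram S n m) (E : Diagram S m k) :
    glueTop q E.cls (ofDiagram R q D) = ofDiagram R q (D.comp E) :=
  liftOp_mk q _ _ _

/-- The bilinear gluing map: `glue q x y` has `x` at the bottom (inside) and `y` on top
(outside). -/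
def glue {S : Shape} {n m k : ℕ} :
    TL R q S n m →ₗ[R] TL R q S m k →ₗ[R] TL R q S n k :=
  LinearMap.flip (Submodule.liftQ _ (Finsupp.lift _ R _ (fun y => glueTop q y)) (by
    refine Submodule.span_le.2 ?_
    rintro _ ⟨l, D, i, hi, F, rfl⟩
    rw [SetLike.mem_coe, LinearMap.mem_ker, map_sub, map_smul]
    simp only [Finsupp.lift_apply, Finsupp.sum_single_index, zero_smul, one_smul]
    apply Submodule.linearMap_qext
    apply Finsupp.lhom_ext'
    intro x
    ext
    induction x using Quotient.inductionOn with
    | h E =>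
      have h := ofDiagram_circle q (E.comp D) i hi F
      rw [← sub_eq_zero] at h
      have h₁ : ((((E.comp D).cup i hi).cap i hi).comp F) =
          E.comp (((D.cup i hi).cap i hi).comp F) :=
        Diagram.comp_assoc E ((D.cup i hi).cap i hi) F
      have h₂ := Diagram.comp_assoc E D F
      rw [h₁, h₂] at h
      rw [← glueTop_ofDiagram, ← glueTop_ofDiagram] at h
      exact h))

theorem glue_ofDiagram {S : Shape} {n m k : ℕ} (D : Diagram S n m) (E : Diagram S m k) :
    glue q (ofDiagram R q D) (ofDiagram R q E) = ofDiagram R q (D.comp E) := by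
  have h : glue q (ofDiagram R q D) (ofDiagram R q E) =
      Finsupp.lift (TL R q S n m →ₗ[R] TL R q S n k) R (Multicurve S m k)
        (fun y => glueTop q y) (Finsupp.single E.cls 1) (ofDiagram R q D) := rfl
  rw [h, Finsupp.lift_apply, Finsupp.sum_single_index (by exact zero_smul R _), one_smul]
  exact glueTop_ofDiagram q D E

/-- `k` more strands on the right. -/
def strandsRight {n m : ℕ} : (k : ℕ) →
    TL R q .rectangle n m →ₗ[R] TL R q .rectangle (n + k) (m + k)
  | 0 => LinearMap.id
  | k + 1 => strandRight q ∘ₗ strandsRight k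

/-- `k` more strands on the left. -/
def strandsLeft {n m : ℕ} : (k : ℕ) →
    TL R q .rectangle n m →ₗ[R] TL R q .rectangle (n + k) (m + k)
  | 0 => LinearMap.id
  | k + 1 => strandLeft q ∘ₗ strandsLeft k

/-! ### The ideal generated by an element of the disk -/

/-- The ideal generated by `Q`: the submodule of the Temperley-Lieb space of the annulus spanned by
all elements obtained by gluing `Q`, in a disk inside the annulus, to anything outside the disk.
A multi-curve in the complement of the disk is drawn in general position with the disk upright at
some level, `a` strands passing it on the left and `b` strands on the right: below (inside) that
level it is `α`, above (outside) it is `β`. -/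
def ideal {k : ℕ} (Q : TL R q .rectangle k k) (n m : ℕ) : Submodule R (TL R q .annulus n m) :=
  Submodule.span R {x | ∃ (a b : ℕ) (α : TL R q .annulus n (k + a + b))
    (β : TL R q .annulus (k + a + b) m),
    x = glue q (glue q α (toAnnulus q (strandsRight q b (strandsLeft q a Q)))) β}

/-! ### Closures and the trace -/

end TL

/-- `k` nested local minima: strand `j` is joined to strand `2k - 1 - j`. -/
def nestedCups (S : Shape) : (k : ℕ) → Diagram S 0 (2 * k)
  | 0 => .id
  | k + 1 => (nestedCups S k).cup k (by omega)

/-- `k` nested local maxima: strand `j` is joined to strand `2k - 1 - j`. -/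
def nestedCaps (S : Shape) : (k : ℕ) → Diagram S (2 * k) 0
  | 0 => .id
  | k + 1 => Diagram.comp (Diagram.cap (m := 2 * k) .id k (by omega)) (nestedCaps S k)

/-- All strands of the annulus move `k` places to the right. -/
def rotation (n : ℕ) : (k : ℕ) → Diagram .annulus n n
  | 0 => .id
  | k + 1 => (rotation n k).rot rfl

section TL

variable {R : Type} [CommRing R] (q : Rˣ)

/-- `x` with `k` parallel strands on its right, on `2k` strands. -/
def besideStrands {k : ℕ} (x : TL R q .rectangle k k) : TL R q .rectangle (2 * k) (2 * k) :=
  (two_mul k).symm ▸ strandsRight q k x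

/-- The closure of `x` in the disk: each top point of `x` is joined to the bottom point with the
same number by an arc passing to the right of `x`. -/
def planarClosure {k : ℕ} (x : TL R q .rectangle k k) : TL R q .rectangle 0 0 :=
  glue q (glue q (ofDiagram R q (nestedCups .rectangle k)) (besideStrands q x))
    (ofDiagram R q (nestedCaps .rectangle k))

/-- The closure of `x` in the annulus: each top point of `x` is joined to the bottom point with the
same number by an arc running once around the hole. -/
def annularClosure {k : ℕ} (x : TL R q .rectangle k k) : TL R q .annulus 0 0 :=
  glue q (glue q (glue q (ofDiagram R q (nestedCups .annulus k)) (toAnnulus q (besideStrands q x)))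
    (ofDiagram R q (rotation (2 * k) k))) (ofDiagram R q (nestedCaps .annulus k))

/-- The empty multi-curve in the disk without marked points. -/
def emptyCurve : TL R q .rectangle 0 0 := ofDiagram R q .id

/-! Every element of the Temperley-Lieb space of the disk without marked points is a unique multiple
of the empty multi-curve. Existence: a multi-curve starting from the empty level is a multiple of
one without local maxima. Uniqueness: the spin representation on functions of binary sequences. -/

/-- The binary sequence `w` with the places `i, i+1` deleted. -/
def deletePair (i : ℕ) (w : ℕ → Bool) : ℕ → Bool := fun j => if j < i then w j else w (j + 2)

/-- The binary sequence `w` with `a, b` inserted at the places `i, i+1`. -/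
def insertPair (i : ℕ) (a b : Bool) (w : ℕ → Bool) : ℕ → Bool := fun j =>
  if j < i then w j else if j = i then a else if j = i + 1 then b else w (j - 2)

def cupWeight (a b : Bool) : R := if a = b then 0 else if b then q else 1

/-- The spin state of a multi-curve. -/
def spin {n : ℕ} : {m : ℕ} → Diagram .rectangle n m → (ℕ → Bool) → R
  | _, .id => fun _ => 1
  | _, .cup D i _ => fun w => cupWeight q (w i) (w (i + 1)) * spin D (deletePair i w)
  | _, .cap D i _ => fun w =>
      spin D (insertPair i false true w) + (q⁻¹ : Rˣ) * spin D (insertPair i true false w)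

theorem delete_insert_zigzag_right (i : ℕ) (a b : Bool) (w : ℕ → Bool) (h : b = w i) :
    deletePair i (insertPair (i + 1) a b w) = w := by
  subst h
  funext j
  simp only [deletePair, insertPair]
  split_ifs <;> first | rfl | (congr 1; omega)

theorem delete_insert_zigzag_left (i : ℕ) (a b : Bool) (w : ℕ → Bool) (h : a = w i) :
    deletePair (i + 1) (insertPair i a b w) = w := by
  subst h
  funext j
  simp only [deletePair, insertPair]
  split_ifs <;> first | rfl | (congr 1; omega)

theorem delete_insert (i : ℕ) (a b : Bool) (w : ℕ → Bool) :
    deletePair i (insertPair i a b w) = w := by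
  funext j
  simp only [deletePair, insertPair]
  split_ifs <;> first | rfl | (congr 1; omega)

theorem delete_delete (i j : ℕ) (hij : i ≤ j) (w : ℕ → Bool) :
    deletePair j (deletePair i w) = deletePair i (deletePair (j + 2) w) := by
  funext l
  simp only [deletePair]
  split_ifs <;> first | rfl | (congr 1; omega)

theorem insert_insert (i j : ℕ) (hij : i ≤ j) (a b c d : Bool) (w : ℕ → Bool) :
    insertPair (j + 2) c d (insertPair i a b w) = insertPair i a b (insertPair j c d w) := by
  funext l
  simp only [insertPair]
  split_ifs <;> first | rfl | (congr 1; omega)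

theorem delete_insert_of_le (i j : ℕ) (hij : i ≤ j) (a b : Bool) (w : ℕ → Bool) :
    deletePair i (insertPair (j + 2) a b w) = insertPair j a b (deletePair i w) := by
  funext l
  simp only [insertPair, deletePair]
  split_ifs <;> first | rfl | (congr 1; omega)

theorem delete_insert_of_ge (i j : ℕ) (hij : i ≤ j) (a b : Bool) (w : ℕ → Bool) :
    deletePair (j + 2) (insertPair i a b w) = insertPair i a b (deletePair j w) := by
  funext l
  simp only [insertPair, deletePair]
  split_ifs <;> first | rfl | (congr 1; omega)

theorem spin_eq {n m : ℕ} {D E : Diagram .rectangle n m} (h : Isotopic D E) :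
    spin q D = spin q E := by
  induction h with
  | refl E => rfl
  | symm _ ih => exact ih.symm
  | trans _ _ ih₁ ih₂ => exact ih₁.trans ih₂
  | congr_cup i hi _ ih => simp only [spin, ih]
  | congr_cap i hi _ ih => simp only [spin, ih]
  | zigzag_right E i hi =>
    funext w
    have h₁ : ∀ a b, insertPair (i + 1) a b w i = w i := fun a b => by simp [insertPair]
    have h₂ : ∀ a b, insertPair (i + 1) a b w (i + 1) = a := fun a b => by simp [insertPair]
    simp only [spin, h₁, h₂]
    cases hw : w i
    · rw [delete_insert_zigzag_right i true false w hw.symm]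
      simp [cupWeight]
    · rw [delete_insert_zigzag_right i false true w hw.symm]
      simp [cupWeight]
  | zigzag_left E i hi =>
    funext w
    have h₁ : ∀ a b, insertPair i a b w (i + 1) = b := fun a b => by simp [insertPair]
    have h₂ : ∀ a b, insertPair i a b w (i + 1 + 1) = w i := fun a b => by
      simp only [insertPair]; split_ifs <;> first | omega | rfl
    simp only [spin, h₁, h₂]
    cases hw : w i
    · rw [delete_insert_zigzag_left i false true w hw.symm]
      simp [cupWeight]
    · rw [delete_insert_zigzag_left i true false w hw.symm]
      simp [cupWeight]
  | cup_cup E i j hij hj =>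
    funext w
    have h₁ : deletePair i w j = w (j + 2) := by simp [deletePair, hij]
    have h₂ : deletePair i w (j + 1) = w (j + 2 + 1) := by
      simp only [deletePair]; split_ifs <;> first | omega | rfl
    have h₃ : deletePair (j + 2) w i = w i := by
      simp only [deletePair]; split_ifs <;> first | omega | rfl
    have h₄ : deletePair (j + 2) w (i + 1) = w (i + 1) := by
      simp only [deletePair]; split_ifs <;> first | omega | rfl
    simp only [spin, h₁, h₂, h₃, h₄, delete_delete i j hij]
    ring
  | cap_cap E i j hij hj =>
    funext w
    simp only [spin, insert_insert i j hij]
    ring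
  | cup_cap E i j hij hj =>
    funext w
    have h₁ : ∀ a b, insertPair (j + 2) a b w i = w i := fun a b => by
      simp only [insertPair]; split_ifs <;> first | omega | rfl
    have h₂ : ∀ a b, insertPair (j + 2) a b w (i + 1) = w (i + 1) := fun a b => by
      simp only [insertPair]; split_ifs <;> first | omega | rfl
    simp only [spin, h₁, h₂, delete_insert_of_le i j hij]
    ring
  | cap_cup E i j hij hj =>
    funext w
    have h₁ : ∀ a b, insertPair i a b w (j + 2) = w j := fun a b => by
      simp only [insertPair]; split_ifs <;> first | omega | rfl
    have h₂ : ∀ a b, insertPair i a b w (j + 2 + 1) = w (j + 1) := fun a b => by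
      simp only [insertPair]; split_ifs <;> first | omega | rfl
    simp only [spin, h₁, h₂, delete_insert_of_ge i j hij]
    ring
  | congr_rot hS | congr_unrot hS | unrot_rot hS | rot_unrot hS | rot_zero hS | rot_cup hS
  | rot_rot_cup hS | rot_cap hS | cap_rot_rot hS => cases hS

theorem spin_comp {n k m : ℕ} {D D' : Diagram .rectangle n k} {r : R}
    (h : ∀ w, spin q D' w = r * spin q D w) (F : Diagram .rectangle k m) (w : ℕ → Bool) :
    spin q (D'.comp F) w = r * spin q (D.comp F) w := by
  induction F generalizing w with
  | id => exact h w
  | cup F i hi ih => simp only [Diagram.comp, spin, ih]; ring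
  | cap F i hi ih => simp only [Diagram.comp, spin, ih]; ring
  | rot hS => cases hS
  | unrot hS => cases hS

theorem spin_circle {n k : ℕ} (D : Diagram .rectangle n k) (i : ℕ) (hi : i ≤ k) (w : ℕ → Bool) :
    spin q ((D.cup i hi).cap i hi) w = (q + (q⁻¹ : Rˣ) : R) * spin q D w := by
  have h₁ : ∀ a b, insertPair i a b w i = a := fun a b => by simp [insertPair]
  have h₂ : ∀ a b, insertPair i a b w (i + 1) = b := fun a b => by simp [insertPair]
  simp only [spin, h₁, h₂, delete_insert]
  simp [cupWeight, add_mul]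

/-- The value of the spin state at the zero sequence. -/
def spinClass {n m : ℕ} (x : Multicurve .rectangle n m) : R :=
  Quotient.lift (fun D => spin q D (fun _ => false)) (fun _ _ h => by rw [spin_eq q h]) x

def spinEval (n m : ℕ) : TL R q .rectangle n m →ₗ[R] R :=
  Submodule.liftQ _ (Finsupp.lift R R (Multicurve .rectangle n m) (spinClass q)) (by
    refine Submodule.span_le.2 ?_
    rintro _ ⟨k, D, i, hi, F, rfl⟩
    rw [SetLike.mem_coe, LinearMap.mem_ker, map_sub, map_smul]
    simp only [Finsupp.lift_apply, smul_eq_mul]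
    rw [Finsupp.sum_single_index (zero_mul _), Finsupp.sum_single_index (zero_mul _), one_mul,
      one_mul]
    exact sub_eq_zero.2 (spin_comp q (spin_circle q D i hi) F _))

theorem spinEval_emptyCurve : spinEval q 0 0 (emptyCurve q) = 1 := by
  change Finsupp.lift R R (Multicurve .rectangle 0 0) (spinClass q) (Finsupp.single _ 1) = _
  rw [Finsupp.lift_apply, Finsupp.sum_single_index (by simp), one_smul]
  rfl

/-- Multi-curves without local maxima. -/
def CupsOnly {n : ℕ} : {m : ℕ} → Diagram .rectangle n m → Prop
  | _, .id => True
  | _, .cup D _ _ => CupsOnly D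
  | _, .cap _ _ _ => False

theorem ofDiagram_cup {n m : ℕ} {D E : Diagram .rectangle n m} {r : R}
    (h : ofDiagram R q D = r • ofDiagram R q E) (i : ℕ) (hi : i ≤ m) :
    ofDiagram R q (D.cup i hi) = r • ofDiagram R q (E.cup i hi) := by
  have := congrArg (fun x => glue q x (ofDiagram R q (Diagram.cup .id i hi))) h
  simp only [map_smul, LinearMap.smul_apply, glue_ofDiagram] at this
  exact this

theorem ofDiagram_cap {n m : ℕ} {D E : Diagram .rectangle n (m + 2)} {r : R}
    (h : ofDiagram R q D = r • ofDiagram R q E) (i : ℕ) (hi : i ≤ m) :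
    ofDiagram R q (D.cap i hi) = r • ofDiagram R q (E.cap i hi) := by
  have := congrArg (fun x => glue q x (ofDiagram R q (Diagram.cap .id i hi))) h
  simp only [map_smul, LinearMap.smul_apply, glue_ofDiagram] at this
  exact this

theorem cap_cupsOnly {l : ℕ} (C : Diagram .rectangle 0 l) (hC : CupsOnly C) (m : ℕ)
    (hl : l = m + 2) (i : ℕ) (hi : i ≤ m) :
    ∃ (r : R) (E : Diagram .rectangle 0 m), CupsOnly E ∧
      ofDiagram R q ((hl ▸ C : Diagram .rectangle 0 (m + 2)).cap i hi) = r • ofDiagram R q E := by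
  induction C generalizing m i with
  | id => omega
  | cap C j hj ih => exact hC.elim
  | rot hS => cases hS
  | unrot hS => cases hS
  | @cup l C j hj ih =>
    obtain rfl : l = m := by omega
    rcases lt_trichotomy i j with h | rfl | h
    · rcases Nat.lt_or_ge (i + 1) j with h' | h'
      · obtain ⟨j, rfl⟩ : ∃ j', j = j' + 2 := ⟨j - 2, by omega⟩
        obtain ⟨l, rfl⟩ : ∃ l', l = l' + 2 := ⟨l - 2, by omega⟩
        obtain ⟨r, E, hE, h⟩ := ih hC l rfl i (by omega)
        refine ⟨r, E.cup j (by omega), by simpa only [CupsOnly] using hE, ?_⟩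
        rw [← ofDiagram_cup q h]
        exact ofDiagram_eq q (.cap_cup C i j (by omega) (by omega))
      · obtain rfl : j = i + 1 := by omega
        exact ⟨1, C, hC, by rw [one_smul]; exact ofDiagram_eq q (.zigzag_left C i hj)⟩
    · exact ⟨_, C, hC, ofDiagram_circle q C i hj .id⟩
    · rcases Nat.lt_or_ge (j + 1) i with h' | h'
      · obtain ⟨i, rfl⟩ : ∃ i', i = i' + 2 := ⟨i - 2, by omega⟩
        obtain ⟨l, rfl⟩ : ∃ l', l = l' + 2 := ⟨l - 2, by omega⟩
        obtain ⟨r, E, hE, h⟩ := ih hC l rfl i (by omega)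
        refine ⟨r, E.cup j (by omega), by simpa only [CupsOnly] using hE, ?_⟩
        rw [← ofDiagram_cup q h]
        exact ofDiagram_eq q (.cup_cap C j i (by omega) (by omega))
      · obtain rfl : i = j + 1 := by omega
        exact ⟨1, C, hC, by rw [one_smul]; exact ofDiagram_eq q (.zigzag_right C j hi)⟩

theorem exists_cupsOnly {m : ℕ} (D : Diagram .rectangle 0 m) :
    ∃ (r : R) (E : Diagram .rectangle 0 m), CupsOnly E ∧
      ofDiagram R q D = r • ofDiagram R q E := by
  induction D with
  | id => exact ⟨1, .id, trivial, (one_smul _ _).symm⟩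
  | cup D i hi ih =>
    obtain ⟨r, E, hE, h⟩ := ih
    exact ⟨r, E.cup i hi, hE, ofDiagram_cup q h i hi⟩
  | cap D i hi ih =>
    obtain ⟨r, E, hE, h⟩ := ih
    obtain ⟨s, F, hF, h'⟩ := cap_cupsOnly q E hE _ rfl i hi
    refine ⟨r * s, F, hF, ?_⟩
    rw [ofDiagram_cap q h i hi, mul_smul]
    exact congrArg _ h'
  | rot hS => cases hS
  | unrot hS => cases hS

theorem eq_id_of_cupsOnly {m : ℕ} (D : Diagram .rectangle 0 m) (hD : CupsOnly D) (hm : m = 0) :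
    (hm ▸ D : Diagram .rectangle 0 0) = .id := by
  cases D with
  | id => rfl
  | cup D i hi => omega
  | cap D i hi => exact hD.elim
  | rot hS => cases hS
  | unrot hS => cases hS

theorem exists_smul_emptyCurve (x : TL R q .rectangle 0 0) : ∃ r : R, x = r • emptyCurve q := by
  obtain ⟨f, rfl⟩ := Submodule.Quotient.mk_surjective _ x
  induction f using Finsupp.induction_linear with
  | zero => exact ⟨0, by rw [zero_smul]; rfl⟩
  | add f g hf hg =>
    obtain ⟨r, hr⟩ := hf
    obtain ⟨s, hs⟩ := hg
    exact ⟨r + s, by rw [add_smul, ← hr, ← hs]; rfl⟩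
  | single y c =>
    induction y using Quotient.inductionOn with
    | h D =>
      obtain ⟨r, E, hE, h⟩ := exists_cupsOnly q D
      have hE' : E = .id := eq_id_of_cupsOnly E hE rfl
      subst hE'
      refine ⟨c * r, ?_⟩
      have h' : c • ofDiagram R q D = (c * r) • emptyCurve q := by
        rw [h, mul_smul]; rfl
      rw [← h', ofDiagram, ← Submodule.Quotient.mk_smul, Finsupp.smul_single_one]
      rfl

theorem existsUnique_smul_emptyCurve (x : TL R q .rectangle 0 0) :
    ∃! r : R, x = r • emptyCurve q := by
  obtain ⟨r, hr⟩ := exists_smul_emptyCurve q x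
  refine ⟨r, hr, fun s hs => ?_⟩
  have h := congrArg (spinEval q 0 0) (hs.symm.trans hr)
  simpa [spinEval_emptyCurve] using h

/-- The evaluation of the Temperley-Lieb space of the disk (or sphere) without marked points: the
scalar `r` with `x = r • ∅`. -/
def evaluation (x : TL R q .rectangle 0 0) : R := (existsUnique_smul_emptyCurve q x).choose

/-- The trace: the evaluation of the planar closure. -/
def trace {k : ℕ} (x : TL R q .rectangle k k) : R := evaluation q (planarClosure q x)

/-- The quantum integer `[n] = q^(n-1) + q^(n-3) + ⋯ + q^(1-n)`. -/
def quantumInt (n : ℕ) : R :=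
  ∑ j ∈ Finset.range n, ((q ^ ((n : ℤ) - 1 - 2 * (j : ℤ)) : Rˣ) : R)

end TL

/-! ### The restricted ring and the Jones-Wenzl projectors -/

/-- The power series `s_k = ∑_{i ≥ 0} (q^((2i+1)k-1) - q^((2i+1)k+1))`, for `k ≥ 1`: the expansion
of `1/[k]` in positive powers of `q`. -/
def invQuantumSeries (k : ℕ) : PowerSeries ℤ := by
  classical
  exact PowerSeries.mk fun n =>
    (if ∃ i : ℕ, n + 1 = (2 * i + 1) * k then 1 else 0) -
      (if ∃ i : ℕ, n = (2 * i + 1) * k + 1 then 1 else 0)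

/-- The restricted ring: the subring of the ring `ℤ((q))` of Laurent series generated by `q`, `q⁻¹`
and `s_1, …, s_N`. -/
def RestrictedRing (N : ℕ) : Subring (LaurentSeries ℤ) :=
  Subring.closure ({HahnSeries.single 1 1, HahnSeries.single (-1) 1} ∪
    {x | ∃ k : ℕ, 1 ≤ k ∧ k ≤ N ∧ x = HahnSeries.ofPowerSeries ℤ ℤ (invQuantumSeries k)})

/-- The unit `q` of the restricted ring. -/
def qUnit (N : ℕ) : (RestrictedRing N)ˣ where
  val := ⟨HahnSeries.single 1 1, Subring.subset_closure (by simp)⟩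
  inv := ⟨HahnSeries.single (-1) 1, Subring.subset_closure (by simp)⟩
  val_inv := Subtype.ext (by simp)
  inv_val := Subtype.ext (by simp)

/-- The element `s_k` of the restricted ring, for `1 ≤ k ≤ N` (and `0` otherwise; these other values
are not used). -/
def invQuantumInt (N k : ℕ) : RestrictedRing N :=
  if h : 1 ≤ k ∧ k ≤ N then
    ⟨HahnSeries.ofPowerSeries ℤ ℤ (invQuantumSeries k),
      Subring.subset_closure (Or.inr ⟨k, h.1, h.2, rfl⟩)⟩
  else 0

/-- The restricted Temperley-Lieb space: coefficients in the restricted ring. -/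
abbrev RestrictedTL (N : ℕ) (S : Shape) (n m : ℕ) : Type := TL (RestrictedRing N) (qUnit N) S n m

/-- The generator of the Temperley-Lieb algebra on `n + 2` strands which joins the last two bottom
points by a local maximum and the last two top points by a local minimum. -/
def lastHook (n : ℕ) : Diagram .rectangle (n + 2) (n + 2) :=
  (Diagram.cap (m := n) .id n le_rfl).cup n le_rfl

/-- The Jones-Wenzl projectors `p_0 = ∅`, `p_1 = |` and
`p_n = p_{n-1} ⊗ 1 - ([n-1]/[n]) (p_{n-1} ⊗ 1) e_{n-1} (p_{n-1} ⊗ 1)`, where `1/[n]` stands for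
`s_n`. In the `N`-th restricted Temperley-Lieb space only those with `n ≤ N` are used. -/
def jonesWenzl (N : ℕ) : (n : ℕ) → RestrictedTL N .rectangle n n
  | 0 => ofDiagram _ _ .id
  | 1 => ofDiagram _ _ .id
  | n + 2 =>
    let p := strandRight (qUnit N) (jonesWenzl N (n + 1))
    p - (quantumInt (qUnit N) (n + 1) * invQuantumInt N (n + 2)) •
      glue (qUnit N) (glue (qUnit N) p (ofDiagram _ _ (lastHook n))) p

/-! ### The magic element and handle slides -/

/-- `φ_k`: the projector `p_k` placed in the annulus. -/
def phi (N k : ℕ) : RestrictedTL N .annulus 0 0 := annularClosure (qUnit N) (jonesWenzl N k)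

/-- The magic element `ω_N = ∑_{k=0}^{N} Tr(p_k) φ_k`. -/
def omega (N : ℕ) : RestrictedTL N .annulus 0 0 :=
  ∑ k ∈ Finset.range (N + 1), trace (qUnit N) (jonesWenzl N k) • phi N k

/-- The ideal `⟨p_N⟩` of the restricted Temperley-Lieb space of the annulus. -/
abbrev projectorIdeal (N n m : ℕ) : Submodule (RestrictedRing N) (RestrictedTL N .annulus n m) :=
  ideal (qUnit N) (jonesWenzl N N) n m

/-- An arc in the annulus with both endpoints on the outer circle. -/
def outerArc : Diagram .annulus 0 2 := Diagram.cup .id 0 le_rfl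

/-- The arc with the same endpoints as `outerArc` on the other side of the hole: the band sum of
`outerArc` with a parallel copy of the core circle of the annulus. -/
def outerArcSlid : Diagram .annulus 0 2 := outerArc.rot rfl

/-- An arc in the annulus with both endpoints on the inner circle. -/
def innerArc : Diagram .annulus 2 0 := Diagram.cap (m := 0) .id 0 le_rfl

/-- The arc with the same endpoints as `innerArc` on the other side: the band sum of `innerArc` with
a parallel copy of the core circle of the annulus. -/
def innerArcSlid : Diagram .annulus 2 0 := Diagram.cap (m := 0) (Diagram.rot rfl .id) 0 le_rfl

/-- Invariance under handle slides modulo `⟨p_N⟩` of an element `x` of the Temperley-Lieb space of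
the annulus, in an annulus with any numbers `n`, `m` of marked points on its boundary circles. The
element `x` is placed around the core of the annulus; the rest of the multi-curve lies inside or
outside of it; a strand running next to `x`, outside or inside of it, may be slid over `x`. -/
def HandleSlideInvariant (N : ℕ) (x : RestrictedTL N .annulus 0 0) : Prop :=
  (∀ (n m : ℕ) (α : RestrictedTL N .annulus n 0) (β : RestrictedTL N .annulus 2 m),
    (projectorIdeal N n m).mkQ
        (glue _ (glue _ (glue _ α x) (ofDiagram _ _ outerArc)) β) =
      (projectorIdeal N n m).mkQ
        (glue _ (glue _ (glue _ α x) (ofDiagram _ _ outerArcSlid)) β)) ∧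
  (∀ (n m : ℕ) (α : RestrictedTL N .annulus n 2) (β : RestrictedTL N .annulus 0 m),
    (projectorIdeal N n m).mkQ
        (glue _ (glue _ (glue _ α (ofDiagram _ _ innerArc)) x) β) =
      (projectorIdeal N n m).mkQ
        (glue _ (glue _ (glue _ α (ofDiagram _ _ innerArcSlid)) x) β))

end

end TemperleyLieb

namespace TemperleyLieb

noncomputable section

/-! ### Gluing of elementary layers as linear operators -/

/-! Write ∪x for x with a small arc outside it, ρ for the move of the two outer marked points by one
place (`addRot`), φ_k for the closure of p_k around the hole, and X_k (`openProjector`) for p_{k+1}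
with only its first k strands closed and both ends of the last strand on the outer circle. Sliding
an outer arc over ω replaces ∪ω by ρ∪ω, so (1 - ρ)∪ω has to lie in the ideal.

Apply the partial closure to the Wenzl recursion of p_{k+2}. In the term p_{k+1} e p_{k+1} one
projector can be pushed around the hole until it meets the other (`closeOuter_act`), and the two
merge by idempotence. This gives X_{k+1} = ∪φ_{k+1} - ([k+1]/[k+2]) ρX_k (`openProjector_succ`).
Moreover ρ²X_k = X_k. Hence [k+2](1 - ρ)∪φ_{k+1} = [k+2](1 - ρ)X_{k+1} - [k+1](1 - ρ)X_k, and since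
Tr(p_k) = [k+1] the weighted sum telescopes: the terms of (1 - ρ)∪ω up to N - 1 add up to [N](1 -
ρ)X_{N-1} (`sum_addCup_closedProjector`). Now X_{N-1} contains p_N, and so does the remaining
summand with φ_N; both lie in the ideal.

The inner slide is the mirror image of the outer one. Exchanging the two boundary circles fixes p_N,
hence preserves the ideal, and fixes every φ_k because φ_k is a polynomial in the core circle
(`closedProjector_add_two`).

To calculate without casts between strand numbers, layers become linear operators attached on top,
and p_k becomes one noncommutative polynomial in hooks (`projector`) that acts on every space,
rectangle or annulus, whatever further strands there are on the right. -/

theorem Diagram.id_comp {S : Shape} {n m : ℕ} (D : Diagram S n m) :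
    Diagram.comp .id D = D := by
  induction D with
  | id => rfl
  | cup D i hi ih => simp only [Diagram.comp, ih]
  | cap D i hi ih => simp only [Diagram.comp, ih]
  | rot hS D ih => simp only [Diagram.comp, ih]
  | unrot hS D ih => simp only [Diagram.comp, ih]

section Operators

variable {R : Type} [CommRing R] (q : Rˣ) {S : Shape} {n m k l : ℕ}

/-- Reduces a linear statement to single multi-curves. The case of zero is separate since there may
be no multi-curve at all, when n and m differ in parity. -/
theorem TL.induction {P : TL R q S n m → Prop} (x : TL R q S n m)
    (zero : P 0) (diagram : ∀ D, P (ofDiagram R q D)) (add : ∀ x y, P x → P y → P (x + y))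
    (smul : ∀ (r : R) x, P x → P (r • x)) : P x := by
  induction x using Submodule.Quotient.induction_on with
  | _ f =>
  induction f using Finsupp.induction_linear with
  | zero => exact zero
  | add f g hf hg => exact add _ _ hf hg
  | single y c =>
    induction y using Quotient.inductionOn with
    | h D =>
      have h := smul c _ (diagram D)
      rw [ofDiagram, ← Submodule.Quotient.mk_smul, Finsupp.smul_single_one] at h
      exact h

theorem glue_assoc (x : TL R q S n m) (y : TL R q S m k) (z : TL R q S k l) :
    glue q (glue q x y) z = glue q x (glue q y z) := by
  induction x using TL.induction with
  | zero => simp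
  | add x x' h h' => simp only [map_add, LinearMap.add_apply, h, h']
  | smul r x h => simp only [map_smul, LinearMap.smul_apply, h]
  | diagram D =>
  induction y using TL.induction with
  | zero => simp
  | add x x' h h' => simp only [map_add, LinearMap.add_apply, h, h']
  | smul r x h => simp only [map_smul, LinearMap.smul_apply, h]
  | diagram E =>
  induction z using TL.induction with
  | zero => simp
  | add x x' h h' => simp only [map_add, h, h']
  | smul r x h => simp only [map_smul, h]
  | diagram F => simp only [glue_ofDiagram, Diagram.comp_assoc]

theorem glue_id (x : TL R q S n m) : glue q x (ofDiagram R q .id) = x := by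
  induction x using TL.induction with
  | zero => simp
  | add x x' h h' => simp only [map_add, LinearMap.add_apply, h, h']
  | smul r x h => simp only [map_smul, LinearMap.smul_apply, h]
  | diagram D => rw [glue_ofDiagram]; rfl

theorem id_glue (x : TL R q S n m) : glue q (ofDiagram R q .id) x = x := by
  induction x using TL.induction with
  | zero => simp
  | add x x' h h' => simp only [map_add, h, h']
  | smul r x h => simp only [map_smul, h]
  | diagram D => rw [glue_ofDiagram, Diagram.id_comp]

/-- Gluing a fixed multi-curve on top. -/
def attach (E : Diagram S m k) : TL R q S n m →ₗ[R] TL R q S n k :=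
  (glue q).flip (ofDiagram R q E)

theorem attach_apply (E : Diagram S m k) (x : TL R q S n m) :
    attach q E x = glue q x (ofDiagram R q E) := rfl

theorem attach_ofDiagram (D : Diagram S n m) (E : Diagram S m k) :
    attach q E (ofDiagram R q D) = ofDiagram R q (D.comp E) := glue_ofDiagram q D E

theorem attach_attach (x : TL R q S n m) (E : Diagram S m k) (F : Diagram S k l) :
    attach q F (attach q E x) = attach q (E.comp F) x := by
  simp only [attach_apply, glue_assoc, glue_ofDiagram]

theorem glue_attach (x : TL R q S n m) (y : TL R q S m k) (E : Diagram S k l) :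
    glue q x (attach q E y) = attach q E (glue q x y) := by
  simp only [attach_apply, glue_assoc]

theorem attach_eq {E F : Diagram S m k} (h : Isotopic E F) (x : TL R q S n m) :
    attach q E x = attach q F x := by
  simp only [attach_apply, ofDiagram_eq q h]

theorem attach_id (x : TL R q S n m) : attach q .id x = x := glue_id q x

/-- A new local minimum on top, with ends number `i` and `i + 1`. -/
def addCup (i : ℕ) : TL R q S n m →ₗ[R] TL R q S n (m + 2) :=
  if h : i ≤ m then attach q (.cup .id i h) else 0

/-- A new local maximum on top, joining the strands `i` and `i + 1`. -/
def addCap (i : ℕ) : TL R q S n (m + 2) →ₗ[R] TL R q S n m :=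
  if h : i ≤ m then attach q (.cap .id i h) else 0

/-- All strands move one place to the right. -/
def addRot : TL R q .annulus n m →ₗ[R] TL R q .annulus n m := attach q (.rot rfl .id)

/-- All strands move one place to the left. -/
def addUnrot : TL R q .annulus n m →ₗ[R] TL R q .annulus n m := attach q (.unrot rfl .id)

variable {i j : ℕ}

theorem addCup_eq (h : i ≤ m) (x : TL R q S n m) :
    addCup q i x = attach q (.cup .id i h) x := by
  rw [addCup, dif_pos h]

theorem addCap_eq (h : i ≤ m) (x : TL R q S n (m + 2)) :
    addCap q i x = attach q (.cap .id i h) x := by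
  rw [addCap, dif_pos h]

theorem addCup_eq_zero (h : m < i) (x : TL R q S n m) : addCup q i x = 0 := by
  rw [addCup, dif_neg (by omega)]; rfl

theorem addCup_ofDiagram (h : i ≤ m) (D : Diagram S n m) :
    addCup q i (ofDiagram R q D) = ofDiagram R q (D.cup i h) := by
  rw [addCup_eq q h, attach_ofDiagram]; rfl

theorem addCap_ofDiagram (h : i ≤ m) (D : Diagram S n (m + 2)) :
    addCap q i (ofDiagram R q D) = ofDiagram R q (D.cap i h) := by
  rw [addCap_eq q h, attach_ofDiagram]; rfl

theorem addRot_ofDiagram (D : Diagram .annulus n m) :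
    addRot q (ofDiagram R q D) = ofDiagram R q (D.rot rfl) := attach_ofDiagram q _ _

theorem glue_addCup (x : TL R q S n m) (y : TL R q S m k) (i : ℕ) :
    glue q x (addCup q i y) = addCup q i (glue q x y) := by
  unfold addCup
  split_ifs
  · exact glue_attach q x y _
  · simp

theorem glue_addCap (x : TL R q S n m) (y : TL R q S m (k + 2)) (i : ℕ) :
    glue q x (addCap q i y) = addCap q i (glue q x y) := by
  unfold addCap
  split_ifs
  · exact glue_attach q x y _
  · simp

theorem glue_addRot (x : TL R q .annulus n m) (y : TL R q .annulus m k) :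
    glue q x (addRot q y) = addRot q (glue q x y) := glue_attach q x y _

theorem addCap_addCup_self (h : i ≤ m) (x : TL R q S n m) :
    addCap q i (addCup q i x) = (q + (q⁻¹ : Rˣ) : R) • x := by
  induction x using TL.induction with
  | zero => simp
  | add x x' h h' => simp only [map_add, smul_add, h, h']
  | smul r x h => rw [map_smul, map_smul, h, smul_comm]
  | diagram D =>
    rw [addCup_ofDiagram q h, addCap_ofDiagram q h]
    exact ofDiagram_circle q D i h .id

theorem addCap_succ_addCup (h : i + 1 ≤ m) (x : TL R q S n m) :
    addCap q (i + 1) (addCup q i x) = x := by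
  rw [addCup_eq q (by omega), addCap_eq q h, attach_attach]
  exact (attach_eq q (.zigzag_right .id i h) x).trans (attach_id q x)

theorem addCap_addCup_succ (h : i + 1 ≤ m) (x : TL R q S n m) :
    addCap q i (addCup q (i + 1) x) = x := by
  rw [addCup_eq q h, addCap_eq q (by omega), attach_attach]
  exact (attach_eq q (.zigzag_left .id i h) x).trans (attach_id q x)

theorem addCup_addCup (hij : i ≤ j) (hj : j ≤ m) (x : TL R q S n m) :
    addCup q i (addCup q j x) = addCup q (j + 2) (addCup q i x) := by
  rw [addCup_eq q hj, addCup_eq q (by omega), addCup_eq q (by omega), addCup_eq q (by omega),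
    attach_attach, attach_attach]
  exact attach_eq q (.cup_cup .id i j hij hj) x

theorem addCap_addCap (hij : i ≤ j) (hj : j ≤ m) (x : TL R q S n (m + 2 + 2)) :
    addCap q i (addCap q (j + 2) x) = addCap q j (addCap q i x) := by
  rw [addCap_eq q hj, addCap_eq q (by omega), addCap_eq q (by omega), addCap_eq q (by omega),
    attach_attach, attach_attach]
  exact attach_eq q (.cap_cap .id i j hij hj) x

theorem addCap_addCup_of_le (hij : i ≤ j) (hj : j ≤ m) (x : TL R q S n (m + 2)) :
    addCap q (j + 2) (addCup q i x) = addCup q i (addCap q j x) := by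
  rw [addCap_eq q hj, addCup_eq q (by omega), addCap_eq q (by omega), addCup_eq q (by omega),
    attach_attach, attach_attach]
  exact attach_eq q (.cup_cap .id i j hij hj) x

theorem addCap_addCup_of_ge (hij : i ≤ j) (hj : j ≤ m) (x : TL R q S n (m + 2)) :
    addCap q i (addCup q (j + 2) x) = addCup q j (addCap q i x) := by
  rw [addCup_eq q hj, addCup_eq q (by omega), addCap_eq q (by omega), addCap_eq q (by omega),
    attach_attach, attach_attach]
  exact attach_eq q (.cap_cup .id i j hij hj) x

theorem addUnrot_addRot (x : TL R q .annulus n m) : addUnrot q (addRot q x) = x := by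
  rw [addUnrot, addRot, attach_attach]
  exact (attach_eq q (.unrot_rot rfl .id) x).trans (attach_id q x)

theorem addRot_addUnrot (x : TL R q .annulus n m) : addRot q (addUnrot q x) = x := by
  rw [addUnrot, addRot, attach_attach]
  exact (attach_eq q (.rot_unrot rfl .id) x).trans (attach_id q x)

theorem addRot_addCup (hi : i < m) (x : TL R q .annulus n m) :
    addRot q (addCup q i x) = addCup q (i + 1) (addRot q x) := by
  rw [addCup_eq q (by omega), addCup_eq q (by omega), addRot, addRot, attach_attach, attach_attach]
  exact attach_eq q (.rot_cup rfl .id i hi) x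

theorem addRot_addRot_addCup (x : TL R q .annulus n m) :
    addRot q (addRot q (addCup q m x)) = addCup q 0 x := by
  rw [addCup_eq q (by omega), addCup_eq q (by omega), addRot, attach_attach, attach_attach]
  exact attach_eq q (.rot_rot_cup rfl .id) x

theorem addRot_addCap (hi : i < m) (x : TL R q .annulus n (m + 2)) :
    addRot q (addCap q i x) = addCap q (i + 1) (addRot q x) := by
  rw [addCap_eq q (by omega), addCap_eq q (by omega), addRot, addRot, attach_attach, attach_attach]
  exact attach_eq q (.rot_cap rfl .id i hi) x

theorem addCap_addRot_addRot (x : TL R q .annulus n (m + 2)) :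
    addCap q 0 (addRot q (addRot q x)) = addCap q m x := by
  rw [addCap_eq q (by omega), addCap_eq q (by omega), addRot, attach_attach, attach_attach]
  exact attach_eq q (.cap_rot_rot rfl .id) x

/-- A local maximum joining the strands `i` and `i + 1`, followed by a local minimum at the same
place; zero if there are no such strands. -/
def hook (i : ℕ) : {m : ℕ} → TL R q S n m →ₗ[R] TL R q S n m
  | 0 => 0
  | 1 => 0
  | _ + 2 => addCup q i ∘ₗ addCap q i

theorem hook_apply (i : ℕ) (x : TL R q S n (m + 2)) :
    hook q i x = addCup q i (addCap q i x) := rfl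

theorem glue_hook (x : TL R q S n m) (y : TL R q S m k) (i : ℕ) :
    glue q x (hook q i y) = hook q i (glue q x y) := by
  match k, y with
  | 0, y => simp [hook]
  | 1, y => simp [hook]
  | k + 2, y => rw [hook_apply, hook_apply, glue_addCup, glue_addCap]

theorem hook_comm (hij : i + 2 ≤ j) (x : TL R q S n m) :
    hook q i (hook q j x) = hook q j (hook q i x) := by
  match m, x with
  | 0, x => simp [hook]
  | 1, x => simp [hook]
  | m + 2, x =>
    obtain ⟨j, rfl⟩ : ∃ j', j = j' + 2 := ⟨j - 2, by omega⟩
    -- If the upper hook does not fit on the strands, it is zero by convention, so no bound on `j`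
    -- is needed.
    rcases Nat.lt_or_ge m (j + 2) with h | h
    · simp only [hook_apply, addCup_eq_zero q h, map_zero]
    · obtain ⟨m, rfl⟩ : ∃ m', m = m' + 2 := ⟨m - 2, by omega⟩
      simp only [hook_apply]
      rw [addCap_addCup_of_ge q (by omega) (by omega), addCup_addCup q (by omega) (by omega),
        addCap_addCap q (by omega) (by omega), addCap_addCup_of_le q (by omega) (by omega)]

theorem hook_addCup (hij : i + 2 ≤ j) (hj : j ≤ m) (x : TL R q S n m) :
    hook q i (addCup q j x) = addCup q j (hook q i x) := by
  obtain ⟨m, rfl⟩ : ∃ m', m = m' + 2 := ⟨m - 2, by omega⟩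
  obtain ⟨j, rfl⟩ : ∃ j', j = j' + 2 := ⟨j - 2, by omega⟩
  rw [hook_apply, hook_apply, addCap_addCup_of_ge q (by omega) (by omega),
    addCup_addCup q (by omega) (by omega)]

theorem hook_addCup_of_ge (hij : i ≤ j) (hj : j ≤ m) (x : TL R q S n (m + 2)) :
    hook q (j + 2) (addCup q i x) = addCup q i (hook q j x) := by
  rw [hook_apply, hook_apply, addCap_addCup_of_le q hij hj, addCup_addCup q hij hj]

theorem hook_addCap (hij : i + 2 ≤ j) (hj : j ≤ m) (x : TL R q S n (m + 2)) :
    hook q i (addCap q j x) = addCap q j (hook q i x) := by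
  obtain ⟨m, rfl⟩ : ∃ m', m = m' + 2 := ⟨m - 2, by omega⟩
  obtain ⟨j, rfl⟩ : ∃ j', j = j' + 2 := ⟨j - 2, by omega⟩
  rw [hook_apply, hook_apply, addCap_addCup_of_le q (by omega) (by omega),
    addCap_addCap q (by omega) (by omega)]

/-! ### Polynomials in the hooks -/

/-- The action of noncommutative polynomials in the hooks; the rightmost letter acts first. -/
def act : FreeAlgebra R ℕ →ₐ[R] Module.End R (TL R q S n m) :=
  FreeAlgebra.lift R fun i => hook q i

theorem act_ι (i : ℕ) (x : TL R q S n m) : act q (FreeAlgebra.ι R i) x = hook q i x := by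
  rw [act, FreeAlgebra.lift_ι_apply]

theorem act_one (x : TL R q S n m) : act q 1 x = x := by
  rw [map_one]; rfl

theorem act_mul (v w : FreeAlgebra R ℕ) (x : TL R q S n m) :
    act q (v * w) x = act q v (act q w x) := by
  rw [map_mul]; rfl

variable (R) in
/-- The polynomials in the hooks on the first `k` strands. -/
def hookAlgebra (k : ℕ) : Subalgebra R (FreeAlgebra R ℕ) :=
  Algebra.adjoin R {x | ∃ i, i + 2 ≤ k ∧ x = FreeAlgebra.ι R i}

theorem ι_mem_hookAlgebra (h : i + 2 ≤ k) : FreeAlgebra.ι R i ∈ hookAlgebra R k :=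
  Algebra.subset_adjoin ⟨i, h, rfl⟩

theorem hookAlgebra_mono (h : k ≤ l) : hookAlgebra R k ≤ hookAlgebra R l :=
  Algebra.adjoin_mono fun _ ⟨i, hi, hx⟩ => ⟨i, by omega, hx⟩

/-- A linear map which commutes with the hooks on the first `k` strands commutes with all
polynomials in them. -/
theorem map_act {T : Shape} {n' m' : ℕ} (f : TL R q S n m →ₗ[R] TL R q T n' m')
    (hf : ∀ i, i + 2 ≤ k → ∀ x, f (hook q i x) = hook q i (f x)) {w : FreeAlgebra R ℕ}
    (hw : w ∈ hookAlgebra R k) (x : TL R q S n m) : f (act q w x) = act q w (f x) := by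
  induction hw using Algebra.adjoin_induction generalizing x with
  | mem w hw =>
    obtain ⟨i, hi, rfl⟩ := hw
    rw [act_ι, act_ι, hf i hi]
  | algebraMap r => simp [Algebra.algebraMap_eq_smul_one]
  | add v w _ _ hv hw => simp only [map_add, LinearMap.add_apply, hv, hw]
  | mul v w _ _ hv hw => rw [act_mul, act_mul, hv, hw]

/-- A polynomial has finitely many letters. Thus `map_act` also applies to maps that commute with
all hooks, with no bound on the polynomial. -/
theorem mem_hookAlgebra_top (w : FreeAlgebra R ℕ) : ∃ k, w ∈ hookAlgebra R k := by
  induction w using FreeAlgebra.induction with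
  | grade0 r => exact ⟨0, Subalgebra.algebraMap_mem _ r⟩
  | grade1 i => exact ⟨i + 2, ι_mem_hookAlgebra le_rfl⟩
  | mul v w hv hw =>
    obtain ⟨k, hk⟩ := hv
    obtain ⟨l, hl⟩ := hw
    exact ⟨max k l, mul_mem (hookAlgebra_mono (le_max_left k l) hk)
      (hookAlgebra_mono (le_max_right k l) hl)⟩
  | add v w hv hw =>
    obtain ⟨k, hk⟩ := hv
    obtain ⟨l, hl⟩ := hw
    exact ⟨max k l, add_mem (hookAlgebra_mono (le_max_left k l) hk)
      (hookAlgebra_mono (le_max_right k l) hl)⟩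

theorem glue_act (x : TL R q S n m) (y : TL R q S m k) (w : FreeAlgebra R ℕ) :
    glue q x (act q w y) = act q w (glue q x y) := by
  obtain ⟨l, hl⟩ := mem_hookAlgebra_top w
  exact map_act q (glue q x) (fun i _ y => glue_hook q x y i) hl y

/-- This turns gluing of a projector into the action of its polynomial, and is how diagrams with
projectors become operator expressions. -/
theorem glue_act_id (x : TL R q S n m) (w : FreeAlgebra R ℕ) :
    glue q x (act q w (ofDiagram R q .id)) = act q w x := by
  rw [glue_act, glue_id]

/-- A minimum born to the right of the first `k` strands is distant from every hook on those
strands. -/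
theorem act_addCup {w : FreeAlgebra R ℕ} (hw : w ∈ hookAlgebra R k) (h : k ≤ m)
    (x : TL R q S n m) : act q w (addCup q k x) = addCup q k (act q w x) :=
  (map_act q (addCup q k) (fun _ hi _ => (hook_addCup q hi h _).symm) hw x).symm

theorem act_addCap {w : FreeAlgebra R ℕ} (hw : w ∈ hookAlgebra R k) (h : k ≤ m)
    (x : TL R q S n (m + 2)) : act q w (addCap q k x) = addCap q k (act q w x) :=
  (map_act q (addCap q k) (fun _ hi _ => (hook_addCap q hi h _).symm) hw x).symm

/-! ### Hooks under inclusion in the annulus and under additional strands. -/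

theorem toAnnulus_ofDiagram (D : Diagram .rectangle n m) :
    toAnnulus q (ofDiagram R q D) = ofDiagram R q D.toAnnulus := liftOp_mk q _ _ _

theorem strandRight_ofDiagram (D : Diagram .rectangle n m) :
    strandRight q (ofDiagram R q D) = ofDiagram R q D.strandRight := liftOp_mk q _ _ _

theorem hook_ofDiagram (h : i ≤ m) (D : Diagram S n (m + 2)) :
    hook q i (ofDiagram R q D) = ofDiagram R q ((D.cap i h).cup i h) := by
  rw [hook_apply, addCap_ofDiagram q h, addCup_ofDiagram q h]

theorem toAnnulus_hook (i : ℕ) (x : TL R q .rectangle n m) :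
    toAnnulus q (hook q i x) = hook q i (toAnnulus q x) := by
  match m, x with
  | 0, x => simp [hook]
  | 1, x => simp [hook]
  | m + 2, x =>
    rcases Nat.lt_or_ge m i with h | h
    · simp only [hook_apply, addCup_eq_zero q h, map_zero]
    induction x using TL.induction with
    | zero => simp
    | add x x' h h' => simp only [map_add, h, h']
    | smul r x h => simp only [map_smul, h]
    | diagram D =>
      rw [hook_ofDiagram q h, toAnnulus_ofDiagram, toAnnulus_ofDiagram, hook_ofDiagram q h]
      rfl

theorem strandRight_hook (h : i + 2 ≤ m) (x : TL R q .rectangle n m) :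
    strandRight q (hook q i x) = hook q i (strandRight q x) := by
  obtain ⟨m, rfl⟩ : ∃ m', m = m' + 2 := ⟨m - 2, by omega⟩
  induction x using TL.induction with
  | zero => simp
  | add x x' h h' => simp only [map_add, h, h']
  | smul r x h => simp only [map_smul, h]
  | diagram D =>
    rw [hook_ofDiagram q (by omega), strandRight_ofDiagram, strandRight_ofDiagram]
    exact (hook_ofDiagram q (m := m + 1) (by omega) D.strandRight).symm

theorem toAnnulus_act (w : FreeAlgebra R ℕ) (x : TL R q .rectangle n m) :
    toAnnulus q (act q w x) = act q w (toAnnulus q x) := by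
  obtain ⟨l, hl⟩ := mem_hookAlgebra_top w
  exact map_act q (toAnnulus q) (fun i _ y => toAnnulus_hook q i y) hl x

/-- Strands are numbered from the left, so strands added on the right leave the polynomial
unchanged: p_k and p_k ⊗ 1 are the same polynomial. -/
theorem strandsRight_act {w : FreeAlgebra R ℕ} (hw : w ∈ hookAlgebra R k) (b : ℕ) :
    strandsRight q b (act q w (ofDiagram R q (.id : Diagram .rectangle k k)))
      = act q w (ofDiagram R q .id) := by
  induction b with
  | zero => rfl
  | succ b ih =>
    change strandRight q (strandsRight q b _) = _
    rw [ih, map_act q (strandRight q) (fun i hi y => strandRight_hook q (by omega) y) hw,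
      strandRight_ofDiagram]
    rfl

theorem cast_act_id (h : m = l) (w : FreeAlgebra R ℕ) :
    (h ▸ act q w (ofDiagram R q (.id : Diagram S m m)) : TL R q S l l)
      = act q w (ofDiagram R q .id) := by
  subst h; rfl

theorem besideStrands_act {w : FreeAlgebra R ℕ} (hw : w ∈ hookAlgebra R k) :
    besideStrands q (act q w (ofDiagram R q (.id : Diagram .rectangle k k)))
      = act q w (ofDiagram R q .id) := by
  rw [besideStrands, strandsRight_act q hw]
  exact cast_act_id q (two_mul k).symm w

end Operators

/-! ### Quantum integers -/

section QuantumIntegers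

variable {R : Type} [CommRing R] (q : Rˣ)

theorem quantumInt_one : quantumInt q 1 = 1 := by simp [quantumInt]

theorem quantumInt_succ (n : ℕ) :
    quantumInt q (n + 1) = q * quantumInt q n + ((q ^ (-(n : ℤ)) : Rˣ) : R) := by
  rw [quantumInt, quantumInt, Finset.sum_range_succ, Finset.mul_sum]
  congr 1
  · refine Finset.sum_congr rfl fun j _ => ?_
    rw [← Units.val_mul, ← zpow_one_add]
    congr 2
    push_cast
    ring
  · congr 2
    push_cast
    ring

/-- Eliminate q^{-n} from two consecutive instances of `quantumInt_succ`. -/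
theorem quantumInt_add_two (n : ℕ) :
    quantumInt q (n + 2) + quantumInt q n
      = (q + (q⁻¹ : Rˣ) : R) * quantumInt q (n + 1) := by
  have h₁ := quantumInt_succ q (n + 1)
  have h₂ := quantumInt_succ q n
  have h₃ : ((q ^ (-((n + 1 : ℕ) : ℤ)) : Rˣ) : R)
      = (q⁻¹ : Rˣ) * ((q ^ (-(n : ℤ)) : Rˣ) : R) := by
    rw [← Units.val_mul, ← zpow_neg_one, ← zpow_add]
    congr 2
    push_cast
    ring
  rw [h₃] at h₁
  have h₄ : ((q⁻¹ : Rˣ) : R) * q = 1 := q.inv_mul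
  linear_combination h₁ - ((q⁻¹ : Rˣ) : R) * h₂ - quantumInt q n * h₄

theorem quantumInt_two : quantumInt q 2 = (q + (q⁻¹ : Rˣ) : R) := by
  have h := quantumInt_add_two q 0
  rw [quantumInt_one, mul_one] at h
  simpa [quantumInt] using h

end QuantumIntegers

/-! ### Jones-Wenzl projectors as polynomials in the hooks -/

section Projector

variable {R : Type} [CommRing R] (q : Rˣ) (s : ℕ → R) {S : Shape} {n m k N : ℕ}

/-- The Jones-Wenzl projectors as noncommutative polynomials in the hooks; `s k` stands for the
inverse of the quantum integer `[k]`. -/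
def projector : ℕ → FreeAlgebra R ℕ
  | 0 => 1
  | 1 => 1
  | k + 2 => projector (k + 1) - (quantumInt q (k + 1) * s (k + 2)) •
      (projector (k + 1) * FreeAlgebra.ι R k * projector (k + 1))

theorem projector_mem (k : ℕ) : projector q s k ∈ hookAlgebra R k := by
  induction k with
  | zero => exact one_mem _
  | succ k ih =>
    cases k with
    | zero => exact one_mem _
    | succ k =>
      have h := hookAlgebra_mono (Nat.le_succ (k + 1)) ih
      exact sub_mem h (Subalgebra.smul_mem _
        (mul_mem (mul_mem h (ι_mem_hookAlgebra le_rfl)) h) _)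

theorem act_projector_add_two (k : ℕ) (x : TL R q S n m) :
    act q (projector q s (k + 2)) x = act q (projector q s (k + 1)) x
      - (quantumInt q (k + 1) * s (k + 2)) • act q (projector q s (k + 1))
          (hook q k (act q (projector q s (k + 1)) x)) := by
  rw [projector, map_sub, LinearMap.sub_apply, map_smul, LinearMap.smul_apply, act_mul, act_mul,
    act_ι]

theorem act_projector_one (x : TL R q S n m) : act q (projector q s 1) x = x := by
  rw [projector, act_one]

variable {s}

/-- The projector is idempotent, absorbs the smaller projector, and its partial trace is a multiple
of the smaller projector. -/
theorem projector_properties (hs : ∀ k, 1 ≤ k → k ≤ N → quantumInt q k * s k = 1) (k : ℕ)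
    (hk : k + 1 ≤ N) :
    (∀ {m : ℕ} (x : TL R q S n m), k + 1 ≤ m →
      act q (projector q s (k + 1)) (act q (projector q s (k + 1)) x)
        = act q (projector q s (k + 1)) x) ∧
    (∀ {m : ℕ} (x : TL R q S n m), k + 1 ≤ m →
      act q (projector q s k) (act q (projector q s (k + 1)) x)
        = act q (projector q s (k + 1)) x) ∧
    (∀ {m : ℕ} (x : TL R q S n m), k ≤ m →
      addCap q k (act q (projector q s (k + 1)) (addCup q k x))
        = (quantumInt q (k + 2) * s (k + 1)) • act q (projector q s k) x) := by
  induction k with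
  | zero =>
    refine ⟨fun x _ => by rw [act_projector_one], fun x _ => ?_, fun x h => ?_⟩
    · rw [act_projector_one]; exact act_projector_one q s x
    · have h₁ : s 1 = 1 := by simpa [quantumInt_one] using hs 1 le_rfl hk
      rw [act_projector_one, addCap_addCup_self q h, quantumInt_two, h₁, mul_one]
      congr 1
      exact (act_projector_one q s x).symm
  | succ k ih =>
    obtain ⟨idem, absorb, ptrace⟩ := ih (by omega)
    have hmem := projector_mem q s (k + 1)
    have e₁ := hs (k + 1) (by omega) (by omega)
    have e₂ := hs (k + 2) (by omega) hk
    have e₃ := quantumInt_add_two q (k + 1)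
    -- Both terms of the recursion for p_{k+2} have p_{k+1} as leftmost factor, which is idempotent
    -- by induction.
    have absorb' : ∀ {m : ℕ} (x : TL R q S n m), k + 2 ≤ m →
        act q (projector q s (k + 1)) (act q (projector q s (k + 2)) x)
          = act q (projector q s (k + 2)) x := fun {m} x h => by
      have idem' := fun y => idem (m := m) y (by omega)
      simp only [act_projector_add_two, map_sub, map_smul, idem']
    -- A maximum at the last two strands kills p_{k+2}: in the second term the partial trace of
    -- p_{k+1} appears and yields ([k+2]/[k+1]) p_k, which is absorbed by p_{k+1}. The coefficients
    -- cancel, leaving the first term once more with opposite sign.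
    have kill : ∀ {m : ℕ} (x : TL R q S n (m + 2)), k ≤ m →
        addCap q k (act q (projector q s (k + 2)) x) = 0 := fun x h => by
      rw [act_projector_add_two, map_sub, map_smul, hook_apply, ptrace _ h,
        act_addCap q (projector_mem q s k) h, absorb _ (by omega), smul_smul, sub_eq_zero]
      have : quantumInt q (k + 1) * s (k + 2) * (quantumInt q (k + 2) * s (k + 1)) = 1 := by
        linear_combination quantumInt q (k + 2) * s (k + 2) * e₁ + e₂
      rw [this, one_smul]
    refine ⟨fun {m} x h => ?_, absorb', fun x h => ?_⟩
    -- Expand only the left factor of p_{k+2} p_{k+2}: its hook term vanishes by `kill`, its first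
    -- term is absorbed.
    · obtain ⟨m, rfl⟩ : ∃ m', m = m' + 2 := ⟨m - 2, by omega⟩
      rw [act_projector_add_two, absorb' x h, hook_apply, kill x (by omega), map_zero, map_zero,
        smul_zero, sub_zero]
    -- The first term closes a circle and gives [2] p_{k+1}. In the second the closing arc
    -- straightens by two zigzags and leaves p_{k+1} p_{k+1} = p_{k+1}. The total is [2] -
    -- [k+1]/[k+2] = [k+3]/[k+2].
    · rw [act_projector_add_two, map_sub, map_smul, act_addCup q hmem h, hook_apply,
        addCap_addCup_succ q h, ← act_addCap q hmem h,
        addCap_addCup_self q h, addCap_succ_addCup q h, idem _ h, ← sub_smul]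
      congr 1
      linear_combination (-(q + (q⁻¹ : Rˣ) : R)) * e₂ - s (k + 2) * e₃

theorem act_projector_idem (hs : ∀ k, 1 ≤ k → k ≤ N → quantumInt q k * s k = 1)
    (hk : k + 1 ≤ N) (x : TL R q S n m) (h : k + 1 ≤ m) :
    act q (projector q s (k + 1)) (act q (projector q s (k + 1)) x)
      = act q (projector q s (k + 1)) x :=
  (projector_properties q hs k hk).1 x h

theorem partialTrace_projector (hs : ∀ k, 1 ≤ k → k ≤ N → quantumInt q k * s k = 1)
    (hk : k + 1 ≤ N) (x : TL R q S n m) (h : k ≤ m) :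
    addCap q k (act q (projector q s (k + 1)) (addCup q k x))
      = (quantumInt q (k + 2) * s (k + 1)) • act q (projector q s k) x :=
  (projector_properties q hs k hk).2.2 x h

end Projector

/-! ### Traces of the projectors in the disk. -/

section Closure

variable {R : Type} [CommRing R] (q : Rˣ) {S : Shape} {n m k N i j : ℕ}

variable (S) in
/-- `k` nested local minima. -/
def nest (k : ℕ) : TL R q S 0 (2 * k) := ofDiagram R q (nestedCups S k)

theorem nest_succ (k : ℕ) : nest q S (k + 1) = addCup q k (nest q S k) :=
  (addCup_ofDiagram q (by omega) _).symm

/-- Hooks slide through the nested local minima. -/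
theorem hook_nest (hi : i + 2 ≤ k) (hj : i + j + 2 = 2 * k) :
    hook q i (nest q S k) = hook q j (nest q S k) := by
  induction k generalizing i j with
  | zero => omega
  | succ k ih =>
    rw [nest_succ]
    change hook q i (m := 2 * k + 2) _ = hook q j (m := 2 * k + 2) _
    rcases Nat.lt_or_ge k (i + 2) with h | h
    -- At the innermost arc each hook straightens a zigzag, and on both sides the two innermost
    -- nested minima become two adjacent ones.
    · obtain rfl : k = i + 1 := by omega
      obtain rfl : j = i + 2 := by omega
      rw [hook_apply, hook_apply, addCap_addCup_succ q (m := 2 * (i + 1)) (by omega),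
        addCap_succ_addCup q (m := 2 * (i + 1)) (by omega), nest_succ]
      exact addCup_addCup (m := 2 * i) q le_rfl (by omega) _
    · obtain ⟨j, rfl⟩ : ∃ j', j = j' + 2 := ⟨j - 2, by omega⟩
      obtain ⟨k, rfl⟩ : ∃ k', k = k' + 1 := ⟨k - 1, by omega⟩
      rw [hook_addCup q h (m := 2 * (k + 1)) (by omega), ih (j := j) h (by omega)]
      exact (hook_addCup_of_ge (m := 2 * k) q (by omega) (by omega) _).symm

theorem glue_nestedCaps_succ (y : TL R q S n (2 * k + 2)) :
    glue q y (ofDiagram R q (nestedCaps S (k + 1)))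
      = glue q (addCap q k y) (ofDiagram R q (nestedCaps S k)) := by
  rw [addCap_eq q (by omega), attach_apply, glue_assoc, glue_ofDiagram]
  rfl

variable {s : ℕ → R}

/-- The trace is a chosen scalar; by uniqueness of the multiple of the empty curve, any computed
value is the trace. -/
theorem trace_act {w : FreeAlgebra R ℕ} (hw : w ∈ hookAlgebra R k) {r : R}
    (h : glue q (act q w (nest q .rectangle k)) (ofDiagram R q (nestedCaps .rectangle k))
      = r • emptyCurve q) :
    trace q (act q w (ofDiagram R q (.id : Diagram .rectangle k k))) = r := by
  rw [trace, planarClosure, besideStrands_act q hw, glue_act_id]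
  exact (existsUnique_smul_emptyCurve q _).unique
    (existsUnique_smul_emptyCurve q _).choose_spec.1 h

/-- The strands are closed from the innermost one outwards. Each partial trace contributes
[k+2]/[k+1], and the product of these factors telescopes. -/
theorem glue_projector_nestedCaps (hs : ∀ k, 1 ≤ k → k ≤ N → quantumInt q k * s k = 1)
    (hk : k ≤ N) :
    glue q (act q (projector q s k) (nest q .rectangle k))
      (ofDiagram R q (nestedCaps .rectangle k)) = quantumInt q (k + 1) • emptyCurve q := by
  induction k with
  | zero =>
    rw [projector, map_one, quantumInt_one, one_smul]
    exact glue_id q _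
  | succ k ih =>
    rw [nest_succ]
    refine (glue_nestedCaps_succ q _).trans ?_
    rw [partialTrace_projector q hs hk _ (by omega), map_smul, LinearMap.smul_apply,
      ih (by omega), smul_smul]
    congr 1
    linear_combination quantumInt q (k + 2) * hs (k + 1) (by omega) hk

theorem trace_projector (hs : ∀ k, 1 ≤ k → k ≤ N → quantumInt q k * s k = 1) (hk : k ≤ N) :
    trace q (act q (projector q s k) (ofDiagram R q (.id : Diagram .rectangle k k)))
      = quantumInt q (k + 1) :=
  trace_act q (projector_mem q s k) (glue_projector_nestedCaps q hs hk)

end Closure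

/-! ### Closing strands around the hole of the annulus -/

section Annulus

variable {R : Type} [CommRing R] (q : Rˣ) {n m k N i j : ℕ}

/-- The first strand is joined to the last one by an arc crossing the cut. -/
def closeStep : TL R q .annulus n (m + 2) →ₗ[R] TL R q .annulus n m := addCap q 0 ∘ₗ addRot q

theorem closeStep_apply (x : TL R q .annulus n (m + 2)) :
    closeStep q x = addCap q 0 (addRot q x) := rfl

theorem closeStep_addCup_succ (h : i ≤ m) (x : TL R q .annulus n (m + 2)) :
    closeStep q (addCup q (i + 1) x) = addCup q i (closeStep q x) := by
  rw [closeStep_apply, closeStep_apply, addRot_addCup q (by omega),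
    addCap_addCup_of_ge q (Nat.zero_le i) h]

theorem closeStep_addCap_succ (h : i ≤ m) (x : TL R q .annulus n (m + 2 + 2)) :
    closeStep q (addCap q (i + 1) x) = addCap q i (closeStep q x) := by
  rw [closeStep_apply, closeStep_apply, addRot_addCap q (by omega),
    addCap_addCap q (Nat.zero_le i) h]

theorem closeStep_hook_succ (h : i ≤ m) (x : TL R q .annulus n (m + 2 + 2)) :
    closeStep q (hook q (i + 1) x) = hook q i (closeStep q x) := by
  rw [hook_apply, hook_apply, closeStep_addCup_succ q h, closeStep_addCap_succ q h]

/-- The closing arc and the minimum form a zigzag with the last strand, which thereby is carried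
across the cut to the first place. -/
theorem closeStep_addCup_zero (h : 1 ≤ m) (x : TL R q .annulus n m) :
    closeStep q (addCup q 0 x) = addRot q x := by
  rw [closeStep_apply, addRot_addCup q h, addCap_addCup_succ q h]

theorem closeStep_addCup_last (h : 1 ≤ m) (x : TL R q .annulus n m) :
    closeStep q (addCup q m x) = addUnrot q x := by
  -- One rotation leaves the last minimum straddling the cut, where no move applies. An extra
  -- rotation brings it to the places 0 and 1.
  rw [← addUnrot_addRot q (closeStep q _), closeStep_apply, addRot_addCap q h,
    addRot_addRot_addCup, addCap_succ_addCup q h]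

/-- The first hook slides through two closing arcs to the last place. -/
theorem closeStep_closeStep_hook (x : TL R q .annulus n (m + 2 + 2)) :
    closeStep q (closeStep q (hook q 0 x)) = closeStep q (closeStep q (hook q (m + 2) x)) := by
  -- Both sides become the same diagram: the first two strands are joined by a maximum, and so are
  -- the last two.
  rw [hook_apply, hook_apply, closeStep_addCup_zero q (by omega),
    closeStep_addCup_last q (by omega), closeStep_apply, closeStep_apply, addCap_addRot_addRot,
    addRot_addUnrot, addCap_addCap q (Nat.zero_le m) le_rfl]

/-- The first `k` strands are joined to the last `k` strands around the hole. -/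
def closeAll : (k : ℕ) → TL R q .annulus n (2 * k) →ₗ[R] TL R q .annulus n 0
  | 0 => LinearMap.id
  | k + 1 => closeAll k ∘ₗ closeStep q (m := 2 * k)

/-- The first `k` strands are joined to the last `k` strands around the hole, two strands in the
middle stay open. -/
def closeOuter : (k : ℕ) → TL R q .annulus n (2 * k + 2) →ₗ[R] TL R q .annulus n 2
  | 0 => LinearMap.id
  | k + 1 => closeOuter k ∘ₗ closeStep q (m := 2 * k + 2)

theorem closeAll_succ (k : ℕ) (x : TL R q .annulus n (2 * k + 2)) :
    closeAll q (k + 1) x = closeStep q (closeOuter q k x) := by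
  induction k with
  | zero => rfl
  | succ k ih => exact ih (closeStep q (m := 2 * k + 2) x)

theorem closeOuter_addCup (k : ℕ) (x : TL R q .annulus n (2 * k)) :
    closeOuter q k (addCup q k x) = addCup q 0 (closeAll q k x) := by
  induction k with
  | zero => rfl
  | succ k ih =>
    change closeOuter q k (closeStep q (addCup q (k + 1) (m := 2 * k + 2) x)) = _
    rw [closeStep_addCup_succ (m := 2 * k) q (by omega), ih]
    rfl

/-- Only the left end of this minimum is among the strands to be closed. The last closing arc
straightens it, so one open end moves across the cut. -/
theorem closeOuter_addCup_pred (k : ℕ) (x : TL R q .annulus n (2 * k + 2)) :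
    closeOuter q (k + 1) (addCup q k x) = addRot q (closeOuter q k x) := by
  induction k with
  | zero => exact closeStep_addCup_zero q (m := 2) (by omega) x
  | succ k ih =>
    change closeOuter q (k + 1) (closeStep q (addCup q (k + 1) (m := 2 * k + 2 + 2) x)) = _
    rw [closeStep_addCup_succ (m := 2 * k + 2) q (by omega)]
    exact ih _

/-- The closing arcs join strand i to strand 2k + 3 - i, so a hook on two closed strands travels
along the arcs to the mirror place. -/
theorem closeOuter_hook (hi : i + 1 ≤ k) (hj : i + j = 2 * k + 2)
    (x : TL R q .annulus n (2 * k + 2 + 2)) :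
    closeOuter q (k + 1) (hook q i x) = closeOuter q (k + 1) (hook q j x) := by
  induction k generalizing i j with
  | zero => omega
  | succ k ih =>
    cases i with
    | zero =>
      obtain rfl : j = 2 * k + 2 + 2 := by omega
      exact congrArg (closeOuter q k) (closeStep_closeStep_hook (m := 2 * k + 2) q x)
    | succ i =>
      obtain ⟨j, rfl⟩ : ∃ j', j = j' + 1 := ⟨j - 1, by omega⟩
      change closeOuter q (k + 1) (closeStep q (hook q (i + 1) (m := 2 * k + 2 + 2 + 2) x))
        = closeOuter q (k + 1) (closeStep q (hook q (j + 1) (m := 2 * k + 2 + 2 + 2) x))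
      rw [closeStep_hook_succ (m := 2 * k + 2) q (by omega),
        closeStep_hook_succ (m := 2 * k + 2) q (by omega)]
      exact ih (by omega) (by omega) _

/-- A polynomial in the hooks slides around the hole. -/
theorem closeOuter_act {v w : FreeAlgebra R ℕ} (hv : v ∈ hookAlgebra R (k + 1))
    (hw : w ∈ hookAlgebra R (k + 1)) :
    closeOuter q (k + 1) (act q w (addCup q k (act q v (nest q .annulus (k + 1)))))
      = addRot q (closeOuter q k (act q v (act q w (nest q .annulus (k + 1))))) := by
  -- The letters of `w` are moved one at a time from its top to the bottom of `v`. The statement is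
  -- strengthened by a remainder `w'` still to be moved and by an arbitrary `v`, which collects the
  -- letters.
  suffices h : ∀ w' ∈ hookAlgebra R (k + 1),
      (∀ v ∈ hookAlgebra R (k + 1),
        closeOuter q (k + 1) (act q w' (addCup q k (act q v (nest q .annulus (k + 1)))))
          = addRot q (closeOuter q k (act q v (act q w' (nest q .annulus (k + 1)))))) →
      ∀ v ∈ hookAlgebra R (k + 1),
        closeOuter q (k + 1) (act q (w * w') (addCup q k (act q v (nest q .annulus (k + 1)))))
          = addRot q (closeOuter q k (act q v (act q (w * w') (nest q .annulus (k + 1))))) by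
    have h' := h 1 (one_mem _) (fun v _ => by
      rw [act_one, act_one]
      exact closeOuter_addCup_pred q k _) v hv
    rwa [mul_one] at h'
  clear hv v
  induction hw using Algebra.adjoin_induction with
  | mem w hw =>
    obtain ⟨i, hi, rfl⟩ := hw
    intro w' hw' ih v hv
    -- The path of the hook: from place i around the hole to place j + 2 on the right; down past
    -- `w'`; past the minimum at k, which lowers its place to j; past `v`; and through the nested
    -- minima back to place i, now below `v`.
    obtain ⟨j, hj⟩ : ∃ j, i + j = 2 * k := ⟨2 * k - i, by omega⟩
    have h₁ : ∀ x : TL R q .annulus 0 (2 * k + 2 + 2),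
        hook q (j + 2) (act q w' x) = act q w' (hook q (j + 2) x) :=
      map_act q (hook q (j + 2)) (fun i hi x => (hook_comm q (by omega) x).symm) hw'
    have h₂ : ∀ x : TL R q .annulus 0 (2 * k + 2),
        hook q j (act q v x) = act q v (hook q j x) :=
      map_act q (hook q j) (fun i hi x => (hook_comm q (by omega) x).symm) hv
    rw [act_mul, act_ι]
    refine (closeOuter_hook q (j := j + 2) (by omega) (by omega) _).trans ?_
    rw [h₁]
    have h₃ := hook_addCup_of_ge q (m := 2 * k) (i := k) (j := j) (by omega) (by omega)
      (act q v (nest q .annulus (k + 1)))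
    have h₄ := hook_nest q (S := .annulus) hi (j := j) (by omega)
    refine (congrArg (fun x => closeOuter q (k + 1) (act q w' x)) h₃).trans ?_
    refine (congrArg (fun x => closeOuter q (k + 1) (act q w' (addCup q k x))) (h₂ _)).trans ?_
    have h₅ := ih (v * FreeAlgebra.ι R i) (mul_mem hv (ι_mem_hookAlgebra hi))
    rw [act_mul, act_mul, act_ι, act_ι] at h₅
    refine (congrArg (fun x => closeOuter q (k + 1) (act q w' (addCup q k (act q v x))))
      h₄.symm).trans (h₅.trans ?_)
    rw [act_mul, act_ι]
  | algebraMap r =>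
    intro w' _ ih v hv
    simp only [Algebra.algebraMap_eq_smul_one, smul_mul_assoc, one_mul, map_smul,
      LinearMap.smul_apply, ih v hv]
  | add w₁ w₂ _ _ h₁ h₂ =>
    intro w' hw' ih v hv
    have h₁ := h₁ w' hw' ih v hv
    have h₂ := h₂ w' hw' ih v hv
    simp only [add_mul, map_add, LinearMap.add_apply, h₁, h₂]
  | mul w₁ w₂ hw₁ hw₂ h₁ h₂ =>
    intro w' hw' ih
    rw [mul_assoc]
    exact h₁ _ (mul_mem hw₂ hw') (h₂ w' hw' ih)

theorem glue_rotation (y : TL R q .annulus n m) (k : ℕ) :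
    glue q y (ofDiagram R q (rotation m (k + 1)))
      = addRot q (glue q y (ofDiagram R q (rotation m k))) := by
  rw [← glue_addRot, addRot_ofDiagram]
  rfl

/-- The first rotation puts the last strand beside the first one, where the maximum at place 0 is a
closing step; the k other rotations carry this maximum to place k. -/
theorem addCap_rotation (h : k ≤ m) (y : TL R q .annulus n (m + 2)) :
    addCap q k (glue q y (ofDiagram R q (rotation (m + 2) (k + 1))))
      = glue q (closeStep q y) (ofDiagram R q (rotation m k)) := by
  induction k with
  | zero =>
    rw [glue_rotation]
    simp only [rotation, glue_id]
    rfl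
  | succ k ih =>
    rw [glue_rotation, ← addRot_addCap q (by omega), ih (by omega), glue_rotation]

theorem glue_rotation_nestedCaps (y : TL R q .annulus n (2 * k)) :
    glue q (glue q y (ofDiagram R q (rotation (2 * k) k))) (ofDiagram R q (nestedCaps .annulus k))
      = closeAll q k y := by
  induction k with
  | zero => exact (glue_id q _).trans (glue_id q y)
  | succ k ih =>
    refine (glue_nestedCaps_succ (k := k) q _).trans ?_
    refine Eq.trans ?_ (ih (closeStep q (m := 2 * k) y))
    exact congrArg (fun x => glue q x _) (addCap_rotation (m := 2 * k) q (by omega) y)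

theorem annularClosure_act {w : FreeAlgebra R ℕ} (hw : w ∈ hookAlgebra R k) :
    annularClosure q (act q w (ofDiagram R q (.id : Diagram .rectangle k k)))
      = closeAll q k (act q w (nest q .annulus k)) := by
  rw [annularClosure, besideStrands_act q hw, toAnnulus_act, toAnnulus_ofDiagram]
  have h : (Diagram.id : Diagram .rectangle (2 * k) (2 * k)).toAnnulus = .id := rfl
  rw [h, glue_act_id]
  exact glue_rotation_nestedCaps q _

end Annulus

/-! ### Closures of the projectors in the annulus -/

section ClosedProjector

variable {R : Type} [CommRing R] (q : Rˣ) (s : ℕ → R) {n m k N : ℕ}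

/-- The projector on `k` strands, closed around the hole. -/
def closedProjector (k : ℕ) : TL R q .annulus 0 0 :=
  closeAll q k (act q (projector q s k) (nest q .annulus k))

/-- The projector on `k + 1` strands with the first `k` strands closed around the hole and both ends
of the last strand on the outer circle. -/
def openProjector (k : ℕ) : TL R q .annulus 0 2 :=
  closeOuter q k (act q (projector q s (k + 1)) (nest q .annulus (k + 1)))

theorem closedProjector_zero : closedProjector q s 0 = ofDiagram R q .id := act_one q _

theorem closedProjector_succ (k : ℕ) :
    closedProjector q s (k + 1) = closeStep q (openProjector q s k) := closeAll_succ q k _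

theorem openProjector_zero : openProjector q s 0 = addCup q 0 (closedProjector q s 0) := by
  rw [closedProjector_zero]
  exact (act_one q _).trans (nest_succ q 0)

variable {s}

/-- This is the Wenzl recursion of p_{k+2} after partial closure. In its first term the last strand
splits off as a separate arc. In the second, a zigzag turns the hook into a minimum at place k, and
the two copies of p_{k+1} merge around the hole, leaving one copy with its open ends moved one
place. -/
theorem openProjector_succ (hs : ∀ k, 1 ≤ k → k ≤ N → quantumInt q k * s k = 1)
    (hk : k + 1 ≤ N) :
    openProjector q s (k + 1) = addCup q 0 (closedProjector q s (k + 1))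
      - (quantumInt q (k + 1) * s (k + 2)) • addRot q (openProjector q s k) := by
  have hmem := projector_mem q s (k + 1)
  have h : ∀ x : TL R q .annulus 0 (2 * k + 2), hook q k (addCup q (k + 1) x) = addCup q k x :=
    fun x => by rw [hook_apply, addCap_addCup_succ q (by omega)]
  rw [openProjector, act_projector_add_two, nest_succ, map_sub, map_smul]
  congr 1
  · rw [act_addCup q hmem (by omega)]
    exact closeOuter_addCup q (k + 1) _
  · congr 1
    rw [act_addCup q hmem (by omega)]
    refine (congrArg (fun x => closeOuter q (k + 1) (act q _ x)) (h _)).trans ?_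
    rw [closeOuter_act q hmem hmem, act_projector_idem q hs hk _ (by omega)]
    rfl

/-- By the recursion it suffices to know that a full turn of both endpoints fixes a single arc
outside everything else. -/
theorem addRot_addRot_openProjector (hs : ∀ k, 1 ≤ k → k ≤ N → quantumInt q k * s k = 1)
    (hk : k ≤ N) : addRot q (addRot q (openProjector q s k)) = openProjector q s k := by
  induction k with
  | zero => rw [openProjector_zero, addRot_addRot_addCup]
  | succ k ih =>
    rw [openProjector_succ q hs hk, map_sub, map_sub, addRot_addRot_addCup, map_smul, map_smul,
      ih (by omega)]

/-- The annular form of the partial trace, with the same coefficient [2] - [k+1]/[k+2] =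
[k+3]/[k+2]: joining the ends of a rotated X_k is a closing step and yields φ_{k+1}. -/
theorem addCap_openProjector (hs : ∀ k, 1 ≤ k → k ≤ N → quantumInt q k * s k = 1)
    (hk : k + 1 ≤ N) :
    addCap q 0 (openProjector q s k)
      = (quantumInt q (k + 2) * s (k + 1)) • closedProjector q s k := by
  cases k with
  | zero =>
    have h₁ : s 1 = 1 := by simpa [quantumInt_one] using hs 1 le_rfl hk
    rw [openProjector_zero, addCap_addCup_self q le_rfl, quantumInt_two, h₁, mul_one]
  | succ k =>
    rw [openProjector_succ q hs (by omega), map_sub, map_smul, addCap_addCup_self q le_rfl,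
      ← closeStep_apply, ← closedProjector_succ, ← sub_smul]
    congr 1
    linear_combination (-(q + (q⁻¹ : Rˣ) : R)) * hs (k + 2) (by omega) hk
      - s (k + 2) * quantumInt_add_two q (k + 1)

/-- The Chebyshev recursion. -/
theorem closedProjector_add_two (hs : ∀ k, 1 ≤ k → k ≤ N → quantumInt q k * s k = 1)
    (hk : k + 2 ≤ N) :
    closedProjector q s (k + 2)
      = closeStep q (addCup q 0 (closedProjector q s (k + 1))) - closedProjector q s k := by
  rw [closedProjector_succ q s (k + 1), openProjector_succ q hs (by omega), map_sub, map_smul]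
  congr 1
  -- The closing step adds a second rotation to ρX_k. As ρ²X_k = X_k, what remains is the partial
  -- trace of X_k, a multiple of φ_k whose factor cancels [k+1]/[k+2].
  rw [closeStep_apply, addRot_addRot_openProjector q hs (by omega),
    addCap_openProjector q hs (by omega), smul_smul]
  have : quantumInt q (k + 1) * s (k + 2) * (quantumInt q (k + 2) * s (k + 1)) = 1 := by
    linear_combination quantumInt q (k + 2) * s (k + 2) * hs (k + 1) (by omega) (by omega)
      + hs (k + 2) (by omega) hk
  rw [this, one_smul]

/-- The telescoping sum behind the handle slide. -/
theorem sum_addCup_closedProjector (hs : ∀ k, 1 ≤ k → k ≤ N → quantumInt q k * s k = 1)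
    (hk : k + 1 ≤ N) :
    ∑ j ∈ Finset.range (k + 1), quantumInt q (j + 1) •
        (addCup q 0 (closedProjector q s j) - addRot q (addCup q 0 (closedProjector q s j)))
      = quantumInt q (k + 1) • (openProjector q s k - addRot q (openProjector q s k)) := by
  induction k with
  | zero => simp [openProjector_zero]
  | succ k ih =>
    rw [Finset.sum_range_succ, ih (by omega)]
    -- After multiplication by [k+2] the coefficient of ρX_k is [k+1], and 1 - ρ turns ρX_k into -(1
    -- - ρ)X_k, which cancels the sum so far.
    have h' : addCup q 0 (closedProjector q s (k + 1)) = openProjector q s (k + 1)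
        + (quantumInt q (k + 1) * s (k + 2)) • addRot q (openProjector q s k) := by
      rw [openProjector_succ q hs (by omega), sub_add_cancel]
    have e : quantumInt q (k + 2) * (quantumInt q (k + 1) * s (k + 2)) = quantumInt q (k + 1) := by
      linear_combination quantumInt q (k + 1) * hs (k + 2) (by omega) hk
    rw [h', map_add, map_smul, addRot_addRot_openProjector q hs (by omega), add_sub_add_comm,
      ← smul_sub, smul_add, smul_smul, e]
    module

/-- The core circle of the annulus. -/
def coreCircle : TL R q .annulus 0 0 := closeStep q (addCup q 0 (ofDiagram R q .id))

theorem closeStep_addCup_eq_glue (x : TL R q .annulus n 0) :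
    closeStep q (addCup q 0 x) = glue q x (coreCircle q) := by
  rw [coreCircle, closeStep_apply, closeStep_apply, glue_addCap, glue_addRot, glue_addCup, glue_id]

/-- By the Chebyshev recursion φ_k is a polynomial in the core circle. This is needed because
reflection reverses the order of gluing. -/
theorem glue_coreCircle_comm (hs : ∀ k, 1 ≤ k → k ≤ N → quantumInt q k * s k = 1) (hk : k ≤ N) :
    glue q (closedProjector q s k) (coreCircle q)
      = glue q (coreCircle q) (closedProjector q s k) := by
  induction k using Nat.strong_induction_on with
  | _ k ih =>
  match k with
  | 0 => rw [closedProjector_zero, id_glue, glue_id]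
  | 1 =>
    rw [closedProjector_succ, openProjector_zero, closeStep_addCup_eq_glue, closedProjector_zero,
      id_glue]
  | k + 2 =>
    rw [closedProjector_add_two q hs hk, closeStep_addCup_eq_glue, map_sub, map_sub,
      LinearMap.sub_apply, ih k (by omega) (by omega), ← glue_assoc,
      ih (k + 1) (by omega) (by omega)]

end ClosedProjector

/-! ### Reflection of the surface -/

section Reflection

variable {S : Shape} {n m k l : ℕ}

/-- The image of a multi-curve under the reflection which exchanges bottom and top. -/
def Diagram.reflect {n : ℕ} : {m : ℕ} → Diagram S n m → Diagram S m n
  | _, .id => .id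
  | _, .cup D i hi => Diagram.comp (.cap .id i hi) D.reflect
  | _, .cap D i hi => Diagram.comp (.cup .id i hi) D.reflect
  | _, .rot hS D => Diagram.comp (.unrot hS .id) D.reflect
  | _, .unrot hS D => Diagram.comp (.rot hS .id) D.reflect

theorem Diagram.reflect_comp (D : Diagram S n m) (E : Diagram S m k) :
    (D.comp E).reflect = E.reflect.comp D.reflect := by
  induction E with
  | id => exact (Diagram.id_comp _).symm
  | cup E i hi ih | cap E i hi ih | rot hS E ih | unrot hS E ih =>
    simp only [Diagram.comp, Diagram.reflect, ih, Diagram.comp_assoc]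

/-- Reflection exchanges `rot` and `unrot`, while the moves across the cut are stated for `rot`.
This lemma and the next three supply the inverse forms, by cancelling rotations. -/
theorem Isotopic.unrot_cup {m : ℕ} (hS : S = .annulus) (D : Diagram S n m) (i : ℕ) (hi : i < m) :
    Isotopic ((D.cup (i + 1) hi).unrot hS) ((D.unrot hS).cup i hi.le) :=
  ((((rot_unrot hS D).symm.congr_cup (i + 1) hi).trans
    (rot_cup hS (D.unrot hS) i hi).symm).congr_unrot hS).trans (unrot_rot hS _)

theorem Isotopic.unrot_cap {m : ℕ} (hS : S = .annulus) (D : Diagram S n (m + 2)) (i : ℕ)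
    (hi : i < m) :
    Isotopic ((D.cap (i + 1) hi).unrot hS) ((D.unrot hS).cap i hi.le) :=
  ((((rot_unrot hS D).symm.congr_cap (i + 1) hi).trans
    (rot_cap hS (D.unrot hS) i hi).symm).congr_unrot hS).trans (unrot_rot hS _)

theorem Isotopic.unrot_unrot_cap {m : ℕ} (hS : S = .annulus) (D : Diagram S n (m + 2)) :
    Isotopic (((D.unrot hS).unrot hS).cap m le_rfl) (D.cap 0 (Nat.zero_le m)) :=
  (cap_rot_rot hS _).symm.trans
    ((((rot_unrot hS _).congr_rot hS).trans (rot_unrot hS D)).congr_cap 0 (Nat.zero_le m))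

theorem Isotopic.unrot_unrot_cup {m : ℕ} (hS : S = .annulus) (D : Diagram S n m) :
    Isotopic (((D.cup 0 (Nat.zero_le m)).unrot hS).unrot hS) (D.cup m le_rfl) :=
  ((((rot_rot_cup hS D).symm.congr_unrot hS).trans (unrot_rot hS _)).congr_unrot hS).trans
    (unrot_rot hS _)

/-- Reflection permutes the elementary moves: the zigzags are exchanged, `cup_cup` with `cap_cap`,
`cup_cap` with `cap_cup`, and the moves across the cut go to their `unrot` forms. The changed layers
now lie below the rest, so each move is made on the identity and the reflected rest is glued on top.
-/
theorem Isotopic.reflect {n m : ℕ} {D E : Diagram S n m} (h : Isotopic D E) :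
    Isotopic D.reflect E.reflect := by
  induction h with
  | refl E => exact .refl _
  | symm _ ih => exact .symm ih
  | trans _ _ ih₁ ih₂ => exact .trans ih₁ ih₂
  | congr_cup i hi _ ih => exact .comp_right _ ih
  | congr_cap i hi _ ih => exact .comp_right _ ih
  | congr_rot hS _ ih => exact .comp_right _ ih
  | congr_unrot hS _ ih => exact .comp_right _ ih
  | zigzag_right D i hi =>
    have h := (zigzag_left (S := S) .id i hi).comp_left D.reflect
    rw [Diagram.id_comp] at h
    simp only [Diagram.reflect, ← Diagram.comp_assoc]
    exact h
  | zigzag_left D i hi =>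
    have h := (zigzag_right (S := S) .id i hi).comp_left D.reflect
    rw [Diagram.id_comp] at h
    simp only [Diagram.reflect, ← Diagram.comp_assoc]
    exact h
  | cup_cup D i j hij hj =>
    have h := (cap_cap (S := S) .id i j hij hj).symm.comp_left D.reflect
    simp only [Diagram.reflect, ← Diagram.comp_assoc]
    exact h
  | cap_cap D i j hij hj =>
    have h := (cup_cup (S := S) .id i j hij hj).symm.comp_left D.reflect
    simp only [Diagram.reflect, ← Diagram.comp_assoc]
    exact h
  | cup_cap D i j hij hj =>
    have h := (cap_cup (S := S) .id i j hij hj).comp_left D.reflect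
    simp only [Diagram.reflect, ← Diagram.comp_assoc]
    exact h
  | cap_cup D i j hij hj =>
    have h := (cup_cap (S := S) .id i j hij hj).comp_left D.reflect
    simp only [Diagram.reflect, ← Diagram.comp_assoc]
    exact h
  | unrot_rot hS D =>
    have h := (unrot_rot (n := _) hS .id).comp_left D.reflect
    rw [Diagram.id_comp] at h
    simp only [Diagram.reflect, ← Diagram.comp_assoc]
    exact h
  | rot_unrot hS D =>
    have h := (rot_unrot hS .id).comp_left D.reflect
    rw [Diagram.id_comp] at h
    simp only [Diagram.reflect, ← Diagram.comp_assoc]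
    exact h
  | rot_zero hS D =>
    have h := (((rot_zero hS .id).symm.congr_unrot hS).trans (unrot_rot hS .id)).comp_left D.reflect
    rw [Diagram.id_comp] at h
    simp only [Diagram.reflect]
    exact h
  | rot_cup hS D i hi =>
    have h := (unrot_cap hS .id i hi).symm.comp_left D.reflect
    simp only [Diagram.reflect, ← Diagram.comp_assoc]
    exact h
  | rot_rot_cup hS D =>
    have h := (unrot_unrot_cap hS .id).comp_left D.reflect
    simp only [Diagram.reflect, ← Diagram.comp_assoc]
    exact h
  | rot_cap hS D i hi =>
    have h := (unrot_cup hS .id i hi).symm.comp_left D.reflect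
    simp only [Diagram.reflect, ← Diagram.comp_assoc]
    exact h
  | cap_rot_rot hS D =>
    have h := (unrot_unrot_cup hS .id).comp_left D.reflect
    simp only [Diagram.reflect, ← Diagram.comp_assoc]
    exact h

theorem Diagram.strandRight_reflect (D : Diagram .rectangle n m) :
    D.strandRight.reflect = D.reflect.strandRight := by
  induction D with
  | id => rfl
  | cup D i hi ih | cap D i hi ih =>
    simp only [Diagram.reflect, Diagram.strandRight, Diagram.strandRight_comp, ih]
  | rot hS | unrot hS => cases hS

theorem Diagram.strandLeft_reflect (D : Diagram .rectangle n m) :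
    D.strandLeft.reflect = D.reflect.strandLeft := by
  induction D with
  | id => rfl
  | cup D i hi ih | cap D i hi ih =>
    simp only [Diagram.reflect, Diagram.strandLeft, Diagram.strandLeft_comp, ih]
  | rot hS | unrot hS => cases hS

theorem Diagram.toAnnulus_reflect (D : Diagram .rectangle n m) :
    D.toAnnulus.reflect = D.reflect.toAnnulus := by
  induction D with
  | id => rfl
  | cup D i hi ih | cap D i hi ih =>
    simp only [Diagram.reflect, Diagram.toAnnulus, Diagram.toAnnulus_comp, ih]
  | rot hS | unrot hS => cases hS

def Multicurve.reflect (x : Multicurve S n m) : Multicurve S m n :=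
  Quotient.map Diagram.reflect (fun _ _ h => Isotopic.reflect h) x

variable {R : Type} [CommRing R] (q : Rˣ)

/-- The reflection which exchanges bottom and top. -/
def reflect : TL R q S n m →ₗ[R] TL R q S m n :=
  liftOp q Multicurve.reflect (by
    intro k D i hi F
    change ofDiagram R q (Diagram.reflect _) = _ • ofDiagram R q (Diagram.reflect _)
    rw [Diagram.reflect_comp, Diagram.reflect_comp, ← ofDiagram_circle q F.reflect i hi D.reflect]
    simp only [Diagram.reflect, ← Diagram.comp_assoc]
    rfl)

theorem reflect_ofDiagram (D : Diagram S n m) :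
    reflect q (ofDiagram R q D) = ofDiagram R q D.reflect := liftOp_mk q _ _ _

theorem reflect_glue (x : TL R q S n m) (y : TL R q S m k) :
    reflect q (glue q x y) = glue q (reflect q y) (reflect q x) := by
  induction x using TL.induction with
  | zero => simp
  | add x x' h h' => simp only [map_add, LinearMap.add_apply, h, h']
  | smul r x h => simp only [map_smul, LinearMap.smul_apply, h]
  | diagram D =>
  induction y using TL.induction with
  | zero => simp
  | add x x' h h' => simp only [map_add, LinearMap.add_apply, h, h']
  | smul r x h => simp only [map_smul, LinearMap.smul_apply, h]
  | diagram E => simp only [glue_ofDiagram, reflect_ofDiagram, Diagram.reflect_comp]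

theorem strandLeft_ofDiagram (D : Diagram .rectangle n m) :
    strandLeft q (ofDiagram R q D) = ofDiagram R q D.strandLeft := liftOp_mk q _ _ _

theorem reflect_strandRight (x : TL R q .rectangle n m) :
    reflect q (strandRight q x) = strandRight q (reflect q x) := by
  induction x using TL.induction with
  | zero => simp
  | add x x' h h' => simp only [map_add, h, h']
  | smul r x h => simp only [map_smul, h]
  | diagram D =>
    rw [strandRight_ofDiagram, reflect_ofDiagram, reflect_ofDiagram, strandRight_ofDiagram,
      Diagram.strandRight_reflect]

theorem reflect_strandLeft (x : TL R q .rectangle n m) :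
    reflect q (strandLeft q x) = strandLeft q (reflect q x) := by
  induction x using TL.induction with
  | zero => simp
  | add x x' h h' => simp only [map_add, h, h']
  | smul r x h => simp only [map_smul, h]
  | diagram D =>
    rw [strandLeft_ofDiagram, reflect_ofDiagram, reflect_ofDiagram, strandLeft_ofDiagram,
      Diagram.strandLeft_reflect]

theorem reflect_toAnnulus (x : TL R q .rectangle n m) :
    reflect q (toAnnulus q x) = toAnnulus q (reflect q x) := by
  induction x using TL.induction with
  | zero => simp
  | add x x' h h' => simp only [map_add, h, h']
  | smul r x h => simp only [map_smul, h]
  | diagram D =>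
    rw [toAnnulus_ofDiagram, reflect_ofDiagram, reflect_ofDiagram, toAnnulus_ofDiagram,
      Diagram.toAnnulus_reflect]

theorem reflect_strandsRight (b : ℕ) (x : TL R q .rectangle n m) :
    reflect q (strandsRight q b x) = strandsRight q b (reflect q x) := by
  induction b with
  | zero => rfl
  | succ b ih => exact (reflect_strandRight q _).trans (congrArg (strandRight q) ih)

theorem reflect_strandsLeft (a : ℕ) (x : TL R q .rectangle n m) :
    reflect q (strandsLeft q a x) = strandsLeft q a (reflect q x) := by
  induction a with
  | zero => rfl
  | succ a ih => exact (reflect_strandLeft q _).trans (congrArg (strandLeft q) ih)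

theorem reflect_coreCircle : reflect q (coreCircle (R := R) q) = coreCircle q := by
  rw [coreCircle, closeStep_apply, addCup_ofDiagram q le_rfl, addRot_ofDiagram,
    addCap_ofDiagram q le_rfl, reflect_ofDiagram]
  refine ofDiagram_eq q (.congr_cap 0 le_rfl ?_)
  -- The reflected circle runs through `unrot` in place of `rot`; on a single arc the two agree,
  -- since two rotations fix it.
  exact ((Isotopic.rot_rot_cup rfl .id).symm.congr_unrot rfl).trans (.unrot_rot rfl _)

variable {s : ℕ → R} {N : ℕ}

theorem reflect_closedProjector (hs : ∀ k, 1 ≤ k → k ≤ N → quantumInt q k * s k = 1)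
    (hk : k ≤ N) : reflect q (closedProjector q s k) = closedProjector q s k := by
  induction k using Nat.strong_induction_on with
  | _ k ih =>
  match k with
  | 0 => rw [closedProjector_zero, reflect_ofDiagram]; rfl
  | 1 =>
    rw [closedProjector_succ, openProjector_zero, closeStep_addCup_eq_glue, closedProjector_zero,
      id_glue, reflect_coreCircle]
  | k + 2 =>
    rw [closedProjector_add_two q hs hk, closeStep_addCup_eq_glue, map_sub, reflect_glue,
      reflect_coreCircle, ih k (by omega) (by omega), ih (k + 1) (by omega) (by omega),
      glue_coreCircle_comm q hs (by omega)]

/-! ### The ideal generated by an element of the disk -/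

variable {Q : TL R q .rectangle k k}

theorem glue_mem_ideal {x : TL R q .annulus n m} (hx : x ∈ ideal q Q n m)
    (y : TL R q .annulus m l) : glue q x y ∈ ideal q Q n l := by
  induction hx using Submodule.span_induction with
  | mem x hx =>
    obtain ⟨a, b, α, β, rfl⟩ := hx
    exact Submodule.subset_span ⟨a, b, α, glue q β y, glue_assoc q _ _ _⟩
  | zero => rw [map_zero, LinearMap.zero_apply]; exact zero_mem _
  | add x x' _ _ h h' => rw [map_add, LinearMap.add_apply]; exact add_mem h h'
  | smul r x _ h => rw [map_smul, LinearMap.smul_apply]; exact Submodule.smul_mem _ r h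

theorem glue_mem_ideal_of_right {x : TL R q .annulus m l} (hx : x ∈ ideal q Q m l)
    (y : TL R q .annulus n m) : glue q y x ∈ ideal q Q n l := by
  induction hx using Submodule.span_induction with
  | mem x hx =>
    obtain ⟨a, b, α, β, rfl⟩ := hx
    exact Submodule.subset_span ⟨a, b, glue q y α, β, by simp only [glue_assoc]⟩
  | zero => rw [map_zero]; exact zero_mem _
  | add x x' _ _ h h' => rw [map_add]; exact add_mem h h'
  | smul r x _ h => rw [map_smul]; exact Submodule.smul_mem _ r h

/-- Since the ideals are stable under gluing on either side, a slide need only be checked with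
nothing else present. -/
theorem mkQ_glue_glue_eq {x y : TL R q .annulus m l} (h : x - y ∈ ideal q Q m l) {n' : ℕ}
    (α : TL R q .annulus n m) (β : TL R q .annulus l n') :
    (ideal q Q n n').mkQ (glue q (glue q α x) β) = (ideal q Q n n').mkQ (glue q (glue q α y) β) := by
  have h' := glue_mem_ideal q (glue_mem_ideal_of_right q h α) β
  rw [map_sub, map_sub, LinearMap.sub_apply] at h'
  exact (Submodule.Quotient.eq _).2 h'

theorem reflect_mem_ideal (hQ : reflect q Q = Q) {x : TL R q .annulus n m}
    (hx : x ∈ ideal q Q n m) : reflect q x ∈ ideal q Q m n := by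
  induction hx using Submodule.span_induction with
  | mem x hx =>
    obtain ⟨a, b, α, β, rfl⟩ := hx
    refine Submodule.subset_span ⟨a, b, reflect q β, reflect q α, ?_⟩
    rw [reflect_glue, reflect_glue, reflect_toAnnulus, reflect_strandsRight, reflect_strandsLeft,
      hQ, glue_assoc]
  | zero => rw [map_zero]; exact zero_mem _
  | add x x' _ _ h h' => rw [map_add]; exact add_mem h h'
  | smul r x _ h => rw [map_smul]; exact Submodule.smul_mem _ r h

theorem addCap_mem_ideal {i : ℕ} {x : TL R q .annulus n (m + 2)}
    (hx : x ∈ ideal q Q n (m + 2)) : addCap q i x ∈ ideal q Q n m := by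
  unfold addCap
  split_ifs
  · exact glue_mem_ideal q hx _
  · exact zero_mem _

theorem closeStep_mem_ideal {x : TL R q .annulus n (m + 2)}
    (hx : x ∈ ideal q Q n (m + 2)) : closeStep q x ∈ ideal q Q n m :=
  addCap_mem_ideal q (i := 0) (glue_mem_ideal q hx (ofDiagram R q (.rot rfl .id)))

theorem closeOuter_mem_ideal (l : ℕ) {x : TL R q .annulus n (2 * l + 2)}
    (hx : x ∈ ideal q Q n (2 * l + 2)) : closeOuter q l x ∈ ideal q Q n 2 := by
  induction l with
  | zero => exact hx
  | succ l ih => exact ih (closeStep_mem_ideal q (m := 2 * l + 2) hx)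

theorem act_mem_ideal {w : FreeAlgebra R ℕ} (hw : w ∈ hookAlgebra R k) (h : k ≤ m)
    (x : TL R q .annulus n m) :
    act q w x ∈ ideal q (act q w (ofDiagram R q (.id : Diagram .rectangle k k))) n m := by
  obtain ⟨b, rfl⟩ := Nat.exists_eq_add_of_le h
  -- The disk lies at the far left with the other b strands on its right, `x` below it and nothing
  -- above.
  refine Submodule.subset_span ⟨0, b, x, ofDiagram R q .id, ?_⟩
  rw [glue_id]
  change _ = glue q x (toAnnulus q (strandsRight q b (act q w _)))
  rw [strandsRight_act q hw, toAnnulus_act, toAnnulus_ofDiagram]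
  exact (glue_act_id q x w).symm

theorem openProjector_mem_ideal (s : ℕ → R) (k : ℕ) :
    openProjector q s k ∈ ideal q (act q (projector q s (k + 1))
      (ofDiagram R q (.id : Diagram .rectangle (k + 1) (k + 1)))) 0 2 :=
  closeOuter_mem_ideal q k (act_mem_ideal q (projector_mem q s _) (by omega) _)

end Reflection

/-! ### The restricted ring -/

/-- The geometric sum for [k], cleared of negative powers and of its denominator. -/
theorem pow_mul_quantumInt {R : Type} [CommRing R] (q : Rˣ) (k : ℕ) :
    (q : R) ^ k * quantumInt q k * (1 - (q : R) ^ 2) = q * (1 - (q : R) ^ (2 * k)) := by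
  induction k with
  | zero => simp [quantumInt]
  | succ k ih =>
    have h : (q : R) ^ k * ((q ^ (-(k : ℤ)) : Rˣ) : R) = 1 := by
      rw [zpow_neg, zpow_natCast, ← Units.val_pow_eq_pow_val]
      exact Units.mul_inv _
    rw [quantumInt_succ]
    linear_combination (q : R) ^ 2 * ih + (q : R) * (1 - (q : R) ^ 2) * h

/-- The series `∑_{i ≥ 0} X^((2i+1)k)`. -/
def oddMultiplesSeries (k : ℕ) : PowerSeries ℤ := by
  classical
  exact PowerSeries.mk fun n => if ∃ i : ℕ, n = (2 * i + 1) * k then 1 else 0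

/-- The factor X removes the shift by -1 in the exponents (2i+1)k - 1, so that both sides are
expressed by the odd multiples of k. -/
theorem X_mul_invQuantumSeries {k : ℕ} (hk : 1 ≤ k) :
    PowerSeries.X * invQuantumSeries k = (1 - PowerSeries.X ^ 2) * oddMultiplesSeries k := by
  ext n
  rw [sub_mul, one_mul, map_sub, PowerSeries.coeff_X_pow_mul']
  match n with
  | 0 =>
    have : ¬ ∃ i : ℕ, 0 = (2 * i + 1) * k := by
      rintro ⟨i, hi⟩
      have : 0 < (2 * i + 1) * k := by positivity
      omega
    simp only [oddMultiplesSeries, PowerSeries.coeff_zero_X_mul, PowerSeries.coeff_mk, if_neg this]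
    simp
  | 1 =>
    rw [show (1 : ℕ) = 0 + 1 from rfl, PowerSeries.coeff_succ_X_mul]
    simp [oddMultiplesSeries, invQuantumSeries]
  | n + 2 =>
    rw [PowerSeries.coeff_succ_X_mul]
    simp only [oddMultiplesSeries, invQuantumSeries, PowerSeries.coeff_mk, le_add_iff_nonneg_left,
      Nat.zero_le, if_true, Nat.add_sub_cancel]
    classical exact congrArg _ (if_congr (exists_congr fun i => Nat.add_right_cancel_iff) rfl rfl)

/-- A geometric series with ratio X^{2k}: all terms cancel except i = 0. -/
theorem one_sub_mul_oddMultiplesSeries {k : ℕ} (hk : 1 ≤ k) :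
    (1 - PowerSeries.X ^ (2 * k)) * oddMultiplesSeries k = PowerSeries.X ^ k := by
  ext n
  rw [sub_mul, one_mul, map_sub, PowerSeries.coeff_X_pow_mul', PowerSeries.coeff_X_pow]
  simp only [oddMultiplesSeries, PowerSeries.coeff_mk]
  by_cases h : ∃ i : ℕ, n = (2 * i + 1) * k
  · obtain ⟨i, rfl⟩ := h
    rw [if_pos ⟨i, rfl⟩]
    cases i with
    | zero => rw [if_neg (by omega), if_pos (by omega), sub_zero]
    | succ i =>
      have e : (2 * (i + 1) + 1) * k = (2 * i + 1) * k + 2 * k := by ring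
      have := Nat.zero_le ((2 * i + 1) * k)
      rw [e, if_pos (by omega), if_pos ⟨i, by omega⟩, if_neg (by omega), sub_self]
  · rw [if_neg h, if_neg (c := n = k) (fun e => h ⟨0, by omega⟩), zero_sub, neg_eq_zero]
    split_ifs with h₁ h₂
    · obtain ⟨i, hi⟩ := h₂
      refine absurd ⟨i + 1, ?_⟩ h
      have e : (2 * (i + 1) + 1) * k = (2 * i + 1) * k + 2 * k := by ring
      omega
    · rfl
    · rfl

theorem quantumInt_mul_invQuantumInt {N : ℕ} (k : ℕ) (h₁ : 1 ≤ k) (h₂ : k ≤ N) :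
    quantumInt (qUnit N) k * invQuantumInt N k = 1 := by
  have hq : ((qUnit N : RestrictedRing N) : LaurentSeries ℤ)
      = HahnSeries.ofPowerSeries ℤ ℤ PowerSeries.X := HahnSeries.ofPowerSeries_X.symm
  have hs : (invQuantumInt N k : LaurentSeries ℤ)
      = HahnSeries.ofPowerSeries ℤ ℤ (invQuantumSeries k) := by
    rw [invQuantumInt, dif_pos ⟨h₁, h₂⟩]
  have e₁ := congrArg (Subtype.val : RestrictedRing N → LaurentSeries ℤ)
    (pow_mul_quantumInt (qUnit N) k)
  have e₂ := congrArg (HahnSeries.ofPowerSeries ℤ ℤ) (X_mul_invQuantumSeries h₁)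
  have e₃ := congrArg (HahnSeries.ofPowerSeries ℤ ℤ) (one_sub_mul_oddMultiplesSeries h₁)
  simp only [map_mul, map_sub, map_one, map_pow, ← hq, ← hs] at e₂ e₃
  push_cast at e₁
  -- With S the series of odd multiples: q^k [k] · q s_k = q^k [k] (1 - q²) S = q (1 - q^{2k}) S = q
  -- · q^k.
  refine (qUnit N ^ (k + 1)).isUnit.mul_left_cancel ?_
  apply Subtype.ext
  push_cast
  linear_combination ((qUnit N : RestrictedRing N) : LaurentSeries ℤ) ^ k *
    ((quantumInt (qUnit N) k : RestrictedRing N) : LaurentSeries ℤ) * e₂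
    + HahnSeries.ofPowerSeries ℤ ℤ (oddMultiplesSeries k) * e₁
    + ((qUnit N : RestrictedRing N) : LaurentSeries ℤ) * e₃

/-! ### Handle slides -/

theorem jonesWenzl_eq (N k : ℕ) :
    jonesWenzl N k = act (qUnit N) (projector (qUnit N) (invQuantumInt N) k)
      (ofDiagram (RestrictedRing N) (qUnit N) .id) := by
  induction k with
  | zero => exact (act_one _ _).symm
  | succ k ih =>
    cases k with
    | zero => exact (act_one _ _).symm
    | succ k =>
      have h : strandRight (qUnit N) (jonesWenzl N (k + 1))
          = act (qUnit N) (projector (qUnit N) (invQuantumInt N) (k + 1))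
            (ofDiagram (RestrictedRing N) (qUnit N) .id) := by
        rw [ih]
        exact strandsRight_act (qUnit N) (projector_mem _ _ _) 1
      have h' : ofDiagram (RestrictedRing N) (qUnit N) (lastHook k)
          = hook (qUnit N) k (ofDiagram _ _ .id) := (hook_ofDiagram (qUnit N) le_rfl _).symm
      rw [jonesWenzl, act_projector_add_two]
      simp only [h, h', glue_hook, glue_act, glue_id]

theorem phi_eq (N k : ℕ) :
    phi N k = closedProjector (qUnit N) (invQuantumInt N) k := by
  rw [phi, jonesWenzl_eq, annularClosure_act (qUnit N) (projector_mem _ _ k)]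
  rfl

theorem trace_jonesWenzl {N k : ℕ} (hk : k ≤ N) :
    trace (qUnit N) (jonesWenzl N k) = quantumInt (qUnit N) (k + 1) := by
  rw [jonesWenzl_eq]
  exact trace_projector (qUnit N) quantumInt_mul_invQuantumInt hk

theorem omega_eq (N : ℕ) :
    omega N = ∑ k ∈ Finset.range (N + 1), quantumInt (qUnit N) (k + 1) •
      closedProjector (qUnit N) (invQuantumInt N) k :=
  Finset.sum_congr rfl fun k hk => by
    rw [trace_jonesWenzl (by have := Finset.mem_range.1 hk; omega), phi_eq]

theorem reflect_lastHook (n : ℕ) : (lastHook n).reflect = lastHook n := rfl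

/-- The Wenzl recursion is a palindrome, p e p, in elements fixed by reflection. -/
theorem reflect_jonesWenzl (N k : ℕ) :
    reflect (qUnit N) (jonesWenzl N k) = jonesWenzl N k := by
  induction k with
  | zero => exact reflect_ofDiagram _ _
  | succ k ih =>
    cases k with
    | zero => exact reflect_ofDiagram _ _
    | succ k =>
      rw [jonesWenzl]
      simp only [map_sub, map_smul, reflect_glue, reflect_strandRight, ih, reflect_ofDiagram,
        reflect_lastHook, glue_assoc]

theorem reflect_omega (N : ℕ) : reflect (qUnit N) (omega N) = omega N := by
  rw [omega_eq, map_sum]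
  refine Finset.sum_congr rfl fun k hk => ?_
  rw [map_smul, reflect_closedProjector (qUnit N) quantumInt_mul_invQuantumInt
    (by have := Finset.mem_range.1 hk; omega)]

theorem outer_slide_mem {N : ℕ} (hN : 0 < N) :
    glue (qUnit N) (omega N) (ofDiagram _ _ outerArc)
      - glue (qUnit N) (omega N) (ofDiagram _ _ outerArcSlid) ∈ projectorIdeal N 0 2 := by
  obtain ⟨k, rfl⟩ : ∃ k, N = k + 1 := ⟨N - 1, by omega⟩
  have h₁ : ofDiagram (RestrictedRing (k + 1)) (qUnit (k + 1)) outerArc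
      = addCup _ 0 (ofDiagram _ _ .id) := (addCup_ofDiagram _ _ _).symm
  have h₂ : ofDiagram (RestrictedRing (k + 1)) (qUnit (k + 1)) outerArcSlid
      = addRot _ (ofDiagram _ _ outerArc) := (addRot_ofDiagram _ _).symm
  have hX : openProjector (qUnit (k + 1)) (invQuantumInt (k + 1)) k
      ∈ projectorIdeal (k + 1) 0 2 := by
    rw [projectorIdeal, jonesWenzl_eq]
    exact openProjector_mem_ideal _ _ _
  have hφ : closedProjector (qUnit (k + 1)) (invQuantumInt (k + 1)) (k + 1)
      ∈ projectorIdeal (k + 1) 0 0 := by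
    rw [closedProjector_succ]
    exact closeStep_mem_ideal _ hX
  have hrot : ∀ {x : RestrictedTL (k + 1) .annulus 0 2}, x ∈ projectorIdeal (k + 1) 0 2 →
      addRot _ x ∈ projectorIdeal (k + 1) 0 2 := fun hx => glue_mem_ideal _ hx _
  have hcup : addCup (qUnit (k + 1)) 0
      (closedProjector (qUnit (k + 1)) (invQuantumInt (k + 1)) (k + 1))
      ∈ projectorIdeal (k + 1) 0 2 := by
    rw [addCup_eq _ le_rfl]
    exact glue_mem_ideal _ hφ _
  -- The summand with φ_N is split off: it lies in the ideal by itself, and the telescoping sum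
  -- stops at N - 1, where p_N first enters through X_{N-1}.
  rw [h₂, h₁, glue_addRot, glue_addCup, glue_id, omega_eq, Finset.sum_range_succ, map_add, map_add,
    map_sum, map_sum, add_sub_add_comm, ← Finset.sum_sub_distrib]
  simp only [map_smul, ← smul_sub]
  rw [sum_addCup_closedProjector _ quantumInt_mul_invQuantumInt le_rfl]
  exact add_mem (Submodule.smul_mem _ _ (sub_mem hX (hrot hX)))
    (Submodule.smul_mem _ _ (sub_mem hcup (hrot hcup)))

theorem inner_slide_mem {N : ℕ} (hN : 0 < N) :
    glue (qUnit N) (ofDiagram _ _ innerArc) (omega N)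
      - glue (qUnit N) (ofDiagram _ _ innerArcSlid) (omega N) ∈ projectorIdeal N 2 0 := by
  have h := reflect_mem_ideal (qUnit N) (reflect_jonesWenzl N N) (outer_slide_mem hN)
  have h₁ : outerArc.reflect = innerArc := rfl
  -- The reflected arc is turned by `unrot`, `innerArcSlid` by `rot`; below a maximum on two strands
  -- they differ by a full turn, which is harmless.
  have h₂ : Isotopic outerArcSlid.reflect innerArcSlid :=
    (Isotopic.cap_rot_rot rfl (.unrot rfl .id)).symm.trans
      (.congr_cap 0 le_rfl (.congr_rot rfl (.rot_unrot rfl .id)))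
  rw [map_sub, reflect_glue, reflect_glue, reflect_omega, reflect_ofDiagram, reflect_ofDiagram, h₁,
    ofDiagram_eq _ h₂] at h
  exact h

end

end TemperleyLieb

theorem mainTheorem4 (N : ℕ) (hN : 0 < N) :
    TemperleyLieb.HandleSlideInvariant N (TemperleyLieb.omega N) := by
  refine ⟨fun n m α β => ?_, fun n m α β => ?_⟩
  -- Reassociate so that ω and the sliding arc form one block between `α` and `β`.
  · rw [TemperleyLieb.glue_assoc _ α (TemperleyLieb.omega N),
      TemperleyLieb.glue_assoc _ α (TemperleyLieb.omega N)]
    exact TemperleyLieb.mkQ_glue_glue_eq _ (TemperleyLieb.outer_slide_mem hN) α β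
  · rw [TemperleyLieb.glue_assoc _ α _ (TemperleyLieb.omega N),
      TemperleyLieb.glue_assoc _ α _ (TemperleyLieb.omega N)]
    exact TemperleyLieb.mkQ_glue_glue_eq _ (TemperleyLieb.inner_slide_mem hN) α β
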